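/- Let $\Gamma=\mathrm{Sp}_2(\mathbb Z)$ be the group of integral symplectic $4\times4$ matrices $M=\begin{pmatrix}A&B\\C&D\end{pmatrix}$ (with $2\times 2$ blocks), acting on the Siegel upper half-space $\mathbb H^{(2)}=\{Z=X+iY\in\mathbb C^{2\times2}: {}^tZ=Z,\ Y>0\}$ by $M\bullet Z=(AZ+B)(CZ+D)^{-1}$. For $w\in\mathbb Z$ put $(F|_wM)(Z)=\det(CZ+D)^{-w}F(M\bullet Z)$, and let $\Delta\subset\Gamma$ be the subgroup of the matrices $\begin{pmatrix}I&B\\0&I\end{pmatrix}$ with $B$ integral and symmetric. For real symmetric positive definite $2\times2$ matrices $T,Y$ and real $\alpha,\beta>\frac12$ put $$h_{\alpha,\beta}(T;Y)=\int_{U\pm T>0}\det(U+T)^{\alpha-\frac32}\det(U-T)^{\beta-\frac32}e^{-2\pi\,\mathrm{tr}(YU)}\,dU,$$ where $U$ runs through the real symmetric $2\times 2$ matrices and $dU=du_{11}\,du_{12}\,du_{22}$. Let $k$ be a positive even integer. Call $b>0$ admissible for $k$ if there is $a>0$ such that for all real symmetric positive definite $2\times2$ matrices $T,Y$, with $\lambda_1$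 the smallest eigenvalue of $TY$, $$\det(TY)\,h_{k+1,1}(T;Y)\le \det(TY)\,2^{2k+2}\pi\,\det(2\pi TY)^{k-\frac12}\det(2\pi Y)^{-k-\frac12}\,a\,e^{-2\pi\,\mathrm{tr}(TY)}\bigl(1+\lambda_1^{-b}\bigr).$$ Then admissible $b$ exist. Moreover, let $b$ be any admissible number for $k$, let $\ell$ be a positive even integer with $\ell+k-2b\ge 6$, and let $T,T'$ be symmetric positive definite half-integral $2\times2$ matrices (that is, the diagonal entries of $T$, $T'$ and all entries of $2T$, $2T'$ are integers). Put $$\Psi_k(T;Z)=\det(TY)\,h_{k+1,1}(T;Y)\,e^{2\pi i\,\mathrm{tr}(TX)},\qquad \Phi_\ell(T';Z)=e^{2\pi i\,\mathrm{tr}(T'Z)}.$$ Then the Poincaré series $$P^{(2)}_{k,\ell;T,T'}(Z)=\sum_{M\in\Delta\backslash\Gamma}\bigl(\Psi_k(T;\cdot)\,\Phi_\ell(T';\cdot)\bigr)\big|_{k+\ell}M\,(Z)$$ converges absolutely and uniformly on compact subsets of $\mathbb H^{(2)}$: on every compact $K\subset\mathbb H^{(2)}$ both this series and the series of the absolute values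 of its terms converge uniformly. -/

import Mathlib

open Matrix Complex MeasureTheory
open scoped Real

noncomputable section

namespace SiegelPoincare

/-- The Siegel upper half-space of degree `2`: complex symmetric `2 × 2` matrices with
positive definite imaginary part (as a subset of all complex `2 × 2` matrices). -/
def siegelUpperHalfSpace : Set (Matrix (Fin 2) (Fin 2) ℂ) :=
  {Z | Z.IsSymm ∧ (Z.map Complex.im).PosDef}

/-- The symplectic group `Γ = Sp₂(ℤ)`, consisting of `4 × 4` integral matrices. -/
abbrev Gam : Type := symplecticGroup (Fin 2) ℤ

/-- The upper left block `A` of `M = (A B; C D)`, with complex entries. -/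
def blockA (M : Gam) : Matrix (Fin 2) (Fin 2) ℂ := M.1.toBlocks₁₁.map Int.cast

/-- The upper right block `B` of `M = (A B; C D)`, with complex entries. -/
def blockB (M : Gam) : Matrix (Fin 2) (Fin 2) ℂ := M.1.toBlocks₁₂.map Int.cast

/-- The lower left block `C` of `M = (A B; C D)`, with complex entries. -/
def blockC (M : Gam) : Matrix (Fin 2) (Fin 2) ℂ := M.1.toBlocks₂₁.map Int.cast

/-- The lower right block `D` of `M = (A B; C D)`, with complex entries. -/
def blockD (M : Gam) : Matrix (Fin 2) (Fin 2) ℂ := M.1.toBlocks₂₂.map Int.cast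

/-- The action `M • Z = (A Z + B) (C Z + D)⁻¹`. -/
def act (M : Gam) (Z : Matrix (Fin 2) (Fin 2) ℂ) : Matrix (Fin 2) (Fin 2) ℂ :=
  (blockA M * Z + blockB M) * (blockC M * Z + blockD M)⁻¹

/-- The slash action `(F |_w M)(Z) = det (C Z + D) ^ (-w) * F (M • Z)`. -/
def slash (w : ℤ) (F : Matrix (Fin 2) (Fin 2) ℂ → ℂ) (M : Gam)
    (Z : Matrix (Fin 2) (Fin 2) ℂ) : ℂ :=
  (blockC M * Z + blockD M).det ^ (-w) * F (act M Z)

/-- The subgroup `Δ` of `Γ` of all matrices `(I B; 0 I)` with `B` integral and symmetric. -/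
def translationSubgroup : Subgroup Gam where
  carrier := {M | ∃ B : Matrix (Fin 2) (Fin 2) ℤ, B.IsSymm ∧ M.1 = fromBlocks 1 B 0 1}
  one_mem' := ⟨0, Matrix.transpose_zero, by simp⟩
  mul_mem' := by
    rintro M N ⟨B, hB, hM⟩ ⟨B', hB', hN⟩
    refine ⟨B' + B, hB'.add hB, ?_⟩
    simp [hM, hN, fromBlocks_multiply]
  inv_mem' := by
    rintro M ⟨B, hB, hM⟩
    refine ⟨-B, hB.neg, ?_⟩
    rw [SymplecticGroup.coe_inv, hM]
    simp [J, fromBlocks_multiply, fromBlocks_transpose, fromBlocks_neg, hB.eq]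

/-- The set `Δ \ Γ` of cosets `Δ M`. -/
abbrev Cosets : Type := Quotient (QuotientGroup.rightRel translationSubgroup)

/-- The real symmetric matrix with entries `u₁₁ = u 0`, `u₁₂ = u 1`, `u₂₂ = u 2`. Through these
coordinates, `dU = du₁₁ du₁₂ du₂₂` is Lebesgue measure on `Fin 3 → ℝ`. -/
def symMat (u : Fin 3 → ℝ) : Matrix (Fin 2) (Fin 2) ℝ := !![u 0, u 1; u 1, u 2]

/-- The confluent hypergeometric function
`h_{α,β}(T; Y) = ∫_{U ± T > 0} det (U + T)^(α - 3/2) det (U - T)^(β - 3/2) e^{-2π tr (Y U)} dU`. -/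
def confluentH (α β : ℝ) (T Y : Matrix (Fin 2) (Fin 2) ℝ) : ℝ :=
  ∫ u in {u : Fin 3 → ℝ | (symMat u + T).PosDef ∧ (symMat u - T).PosDef},
    (symMat u + T).det ^ (α - 3 / 2) * (symMat u - T).det ^ (β - 3 / 2) *
      Real.exp (-2 * π * (Y * symMat u).trace)

/-- `T` is half-integral: its diagonal entries and twice all of its entries are integers. -/
def IsHalfIntegral (T : Matrix (Fin 2) (Fin 2) ℝ) : Prop :=
  (∀ i, ∃ n : ℤ, T i i = n) ∧ ∀ i j, ∃ n : ℤ, 2 * T i j = n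

/-- `Ψ_k(T; Z) = det (T Y) h_{k+1,1}(T; Y) e^{2π i tr (T X)}`, where `Z = X + i Y`. -/
def Psi (k : ℕ) (T : Matrix (Fin 2) (Fin 2) ℝ) (Z : Matrix (Fin 2) (Fin 2) ℂ) : ℂ :=
  (((T * Z.map Complex.im).det * confluentH (k + 1) 1 T (Z.map Complex.im) : ℝ) : ℂ) *
    Complex.exp (2 * π * I * ((T * Z.map Complex.re).trace : ℝ))

/-- `Φ(T; Z) = e^{2π i tr (T Z)}` (it does not depend on the weight). -/
def Phi (T : Matrix (Fin 2) (Fin 2) ℝ) (Z : Matrix (Fin 2) (Fin 2) ℂ) : ℂ :=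
  Complex.exp (2 * π * I * (T.map Complex.ofReal * Z).trace)

/-- The term `(Ψ_k(T; ·) Φ_ℓ(T'; ·)) |_{k+ℓ} M` at `Z` of the Poincaré series. -/
def cosetRepTerm (k l : ℕ) (T T' : Matrix (Fin 2) (Fin 2) ℝ) (M : Gam)
    (Z : Matrix (Fin 2) (Fin 2) ℂ) : ℂ :=
  slash ((k + l : ℕ) : ℤ) (fun W => Psi k T W * Phi T' W) M Z

/-- The term of the Poincaré series for a coset `q = Δ M`, through a representative of `q`.
By `poincareTerm_mk` it does not depend on the choice of the representative. -/
def poincareTerm (k l : ℕ) (T T' : Matrix (Fin 2) (Fin 2) ℝ) (q : Cosets)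
    (Z : Matrix (Fin 2) (Fin 2) ℂ) : ℂ :=
  cosetRepTerm k l T T' q.out Z

/-- The Poincaré series `P_{k,ℓ;T,T'}(Z)`, the sum over `M ∈ Δ \ Γ` of
`((Ψ_k(T; ·) Φ_ℓ(T'; ·)) |_{k+ℓ} M)(Z)`. -/
def poincareSeries (k l : ℕ) (T T' : Matrix (Fin 2) (Fin 2) ℝ)
    (Z : Matrix (Fin 2) (Fin 2) ℂ) : ℂ :=
  ∑' q : Cosets, poincareTerm k l T T' q Z

/-- `b > 0` is an admissible exponent for `k` in Shimura's estimate: for some constant `a > 0` and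
all positive definite `T`, `Y`, with `λ₁` the smallest eigenvalue of `T Y`,
`det (TY) h_{k+1,1}(T; Y)` is at most
`det (TY) 2^{2k+2} π det (2πTY)^{k-1/2} det (2πY)^{-k-1/2} a e^{-2π tr (TY)} (1 + λ₁^{-b})`. -/
def IsShimuraExponent (k : ℕ) (b : ℝ) : Prop :=
  0 < b ∧ ∃ a : ℝ, 0 < a ∧ ∀ T Y : Matrix (Fin 2) (Fin 2) ℝ, T.PosDef → Y.PosDef →
    ∀ lam₁ : ℝ, IsLeast (spectrum ℝ (T * Y)) lam₁ →
      (T * Y).det * confluentH (k + 1) 1 T Y ≤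
        (T * Y).det * 2 ^ (2 * k + 2) * π *
          ((2 * π) • (T * Y)).det ^ ((k : ℝ) - 1 / 2) *
          ((2 * π) • Y).det ^ (-(k : ℝ) - 1 / 2) *
          (a * Real.exp (-2 * π * (T * Y).trace) * (1 + lam₁ ^ (-b)))

/-! The terms of the series are well defined on cosets. -/

theorem Psi_translate (k : ℕ) {T : Matrix (Fin 2) (Fin 2) ℝ} (hT : T.IsSymm)
    (hT' : IsHalfIntegral T) {B : Matrix (Fin 2) (Fin 2) ℤ} (hB : B.IsSymm)
    (Z : Matrix (Fin 2) (Fin 2) ℂ) : Psi k T (Z + B.map Int.cast) = Psi k T Z := by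
  obtain ⟨n, hn⟩ := hT'.1 0
  obtain ⟨m, hm⟩ := hT'.1 1
  obtain ⟨r, hr⟩ := hT'.2 0 1
  have him : (Z + B.map Int.cast : Matrix (Fin 2) (Fin 2) ℂ).map Complex.im = Z.map Complex.im := by
    ext i j; simp
  have hre : (Z + B.map Int.cast : Matrix (Fin 2) (Fin 2) ℂ).map Complex.re
      = Z.map Complex.re + B.map Int.cast := by
    ext i j; simp
  have hb : B 1 0 = B 0 1 := hB.apply 0 1
  have ht : T 1 0 = T 0 1 := hT.apply 0 1
  have htr : (T * B.map Int.cast).trace = ((n * B 0 0 + r * B 0 1 + m * B 1 1 : ℤ) : ℝ) := by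
    simp [Matrix.trace, Matrix.mul_apply, Fin.sum_univ_two, hb, ht, hn, hm]
    rw [← hr]; ring
  unfold Psi
  rw [him, hre, Matrix.mul_add, Matrix.trace_add, htr]
  congr 1
  rw [Complex.exp_eq_exp_iff_exists_int]
  exact ⟨n * B 0 0 + r * B 0 1 + m * B 1 1, by push_cast; ring⟩

theorem Phi_translate {T : Matrix (Fin 2) (Fin 2) ℝ} (hT : T.IsSymm)
    (hT' : IsHalfIntegral T) {B : Matrix (Fin 2) (Fin 2) ℤ} (hB : B.IsSymm)
    (Z : Matrix (Fin 2) (Fin 2) ℂ) : Phi T (Z + B.map Int.cast) = Phi T Z := by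
  obtain ⟨n, hn⟩ := hT'.1 0
  obtain ⟨m, hm⟩ := hT'.1 1
  obtain ⟨r, hr⟩ := hT'.2 0 1
  have hb : B 1 0 = B 0 1 := hB.apply 0 1
  have ht : T 1 0 = T 0 1 := hT.apply 0 1
  have htr : (T.map Complex.ofReal * B.map Int.cast).trace
      = ((n * B 0 0 + r * B 0 1 + m * B 1 1 : ℤ) : ℂ) := by
    have hr' : (2 : ℂ) * (T 0 1 : ℂ) = r := by exact_mod_cast congrArg Complex.ofReal hr
    simp [Matrix.trace, Matrix.mul_apply, Fin.sum_univ_two, hb, ht, hn, hm]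
    rw [← hr']; ring
  unfold Phi
  rw [Matrix.mul_add, Matrix.trace_add, htr, Complex.exp_eq_exp_iff_exists_int]
  exact ⟨n * B 0 0 + r * B 0 1 + m * B 1 1, by push_cast; ring⟩

theorem cosetRepTerm_mul {k l : ℕ} (hk : 0 < k) {T T' : Matrix (Fin 2) (Fin 2) ℝ}
    (hT : T.IsSymm) (hT₂ : IsHalfIntegral T) (hT' : T'.IsSymm) (hT₂' : IsHalfIntegral T')
    {N : Gam} (hN : N ∈ translationSubgroup) (M : Gam) (Z : Matrix (Fin 2) (Fin 2) ℂ) :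
    cosetRepTerm k l T T' (N * M) Z = cosetRepTerm k l T T' M Z := by
  obtain ⟨B, hB, hN⟩ := hN
  have hmul : (N * M).1 = fromBlocks (M.1.toBlocks₁₁ + B * M.1.toBlocks₂₁)
      (M.1.toBlocks₁₂ + B * M.1.toBlocks₂₂) M.1.toBlocks₂₁ M.1.toBlocks₂₂ := by
    conv_lhs => rw [Submonoid.coe_mul, hN, ← fromBlocks_toBlocks M.1]
    simp [fromBlocks_multiply]
  have hC : blockC (N * M) = blockC M := by simp [blockC, hmul]
  have hD : blockD (N * M) = blockD M := by simp [blockD, hmul]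
  have hA : blockA (N * M) = blockA M + B.map Int.cast * blockC M := by
    unfold blockA blockC
    rw [hmul, toBlocks_fromBlocks₁₁]
    ext i j; simp [Matrix.mul_apply]
  have hB' : blockB (N * M) = blockB M + B.map Int.cast * blockD M := by
    unfold blockB blockD
    rw [hmul, toBlocks_fromBlocks₁₂]
    ext i j; simp [Matrix.mul_apply]
  unfold cosetRepTerm slash
  rw [hC, hD]
  by_cases h0 : (blockC M * Z + blockD M).det = 0
  · rw [h0, _root_.zero_zpow _ (by omega), zero_mul, zero_mul]
  · have hact : act (N * M) Z = act M Z + B.map Int.cast := by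
      unfold act
      rw [hA, hB', hC, hD]
      have e : (blockA M + B.map Int.cast * blockC M) * Z + (blockB M + B.map Int.cast * blockD M)
          = (blockA M * Z + blockB M) + B.map Int.cast * (blockC M * Z + blockD M) := by
        noncomm_ring
      rw [e, Matrix.add_mul, Matrix.mul_assoc, Matrix.mul_nonsing_inv _ (Ne.isUnit h0),
        Matrix.mul_one]
    simp only [hact, Psi_translate k hT hT₂ hB, Phi_translate hT' hT₂' hB]

theorem poincareTerm_mk {k l : ℕ} (hk : 0 < k) {T T' : Matrix (Fin 2) (Fin 2) ℝ}
    (hT : T.IsSymm) (hT₂ : IsHalfIntegral T) (hT' : T'.IsSymm) (hT₂' : IsHalfIntegral T')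
    (M : Gam) (Z : Matrix (Fin 2) (Fin 2) ℂ) :
    poincareTerm k l T T' (Quotient.mk _ M) Z = cosetRepTerm k l T T' M Z := by
  have h := QuotientGroup.rightRel_apply.mp
    (Quotient.exact (Quotient.out_eq (Quotient.mk (QuotientGroup.rightRel translationSubgroup) M)))
  have := cosetRepTerm_mul (l := l) hk hT hT₂ hT' hT₂' h
    (Quotient.mk (QuotientGroup.rightRel translationSubgroup) M).out Z
  rw [inv_mul_cancel_right] at this
  exact this.symm

end SiegelPoincare

end

/-!
The terms of the series are compared with a lattice sum over the bottom rows `a`, `r` of `M`. These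
are vectors of `ℤ⁴` that are orthogonal for the symplectic form, and they determine the coset of `M`
modulo `Δ` (`bottomRow_out_injective`).

Let `J = C Z + D`, `δ = |det J|²`, let `W = Im (M • Z)`, and let `Q` be the Gram matrix of `a` and `r`.
From `Jᴴ W J = Im Z` (`im_act`) one gets `δ adj W = J adj(Im Z) Jᴴ`, so the quadratic form of `δ adj W`
is the pullback under `x ↦ x (C D)` of a positive definite form on `ℝ⁴` depending continuously on `Z`
(`siegelForm_bottomRow`). On a compact set this form is bounded below by a multiple of the Euclidean
form, whence `δ tr W ≥ c tr Q` and `δ ≥ c det Q` with `c > 0` independent of `M` and `Z`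
(`im_act_estimates`).

If `b` is admissible, then `det(TY) h_{k+1,1}(T; Y) ≤ C (1 + (det Y)^(-b))`: the powers of determinants
cancel, and the smallest eigenvalue of `TY` is at least `det(TY) / tr(TY)`, where the power of the
trace is absorbed by the exponential (`IsShimuraExponent.exists_le_det`). As `det W = det(Im Z) / δ`,
a term of the series is at most a constant times `δ^(b - (k+l)/2) exp(-c tr Q / δ)`. Since
`k + l - 2b ≥ 6`, this is at most a constant times `δ⁻³ exp(-c tr Q / δ)`, hence a constant times
`(tr Q + det Q)⁻³` (`exists_norm_cosetRepTerm_le`).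

That the sum of `(tr Q + det Q)⁻³` over all isotropic pairs converges (`summable_gramSize_inv`) is
seen as follows. Let `a_i` be a coordinate of `a` of maximal absolute value. Given `a`, the vector `r`
is determined by its coordinates of index `i` and of the two indices `j`, `k` not paired with `i`. By
Lagrange's identity, `det Q` is at least the square of `a_i (r_j - a_j r_i / a_i)`, and likewise for
`k`. With `m_j = r_j - round(a_j r_i / a_i)`, the cube of `tr Q + det Q` is therefore at least
a constant times `a_i⁴ (a_i² + r_i²) (1 + m_j²) (1 + m_k²)`, which dominates a multiple of the product of
`(1 + |n|)^(6/5)` over the seven integers `n` in `(a, r_i, m_j, m_k)`.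

For the existence of admissible exponents, write `T = P Pᵀ` with `Pᵀ Y P = diag(s₀, s₁)` and substitute
`U = P (W + 1) Pᵀ` (`confluentH_eq`). Hadamard's inequality bounds `det(W + 2)` by
`(w₁₁ + 2)(w₂₂ + 2)`, the integral of `(w₁₁ w₂₂ - w₁₂²)^(-1/2)` over `w₁₂` is bounded, and the integrals
of `(2 + w)^k e^(-2πsw)` are at most a constant times `s⁻¹ (1 + s⁻ᵏ)`. So `b = 2k` is admissible
(`isShimuraExponent_two_mul`).
-/

noncomputable section

namespace SiegelPoincare

/-! ### A convergent sum over isotropic pairs of integral vectors -/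

/-- The summable weight `(1 + |n|) ^ (-6/5)` on the integers. -/
def latticeWeight (n : ℤ) : ℝ := (1 + |(n : ℝ)|) ^ (-(6 / 5) : ℝ)

theorem latticeWeight_nonneg (n : ℤ) : 0 ≤ latticeWeight n := by
  unfold latticeWeight; positivity

theorem summable_latticeWeight : Summable latticeWeight := by
  have hnat : Summable fun n : ℕ => (1 + (n : ℝ)) ^ (-(6 / 5) : ℝ) := by
    have h := (summable_nat_add_iff 1).mpr
      (Real.summable_nat_rpow (p := (-(6 / 5) : ℝ)) |>.mpr (by norm_num))
    refine h.congr fun n => ?_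
    push_cast; rw [add_comm]
  apply Summable.of_nat_of_neg
  · simpa [latticeWeight] using hnat
  · simpa [latticeWeight] using hnat

theorem summable_prod_pi {w : ℤ → ℝ} (hw : ∀ n, 0 ≤ w n) (hs : Summable w) (d : ℕ) :
    Summable fun x : Fin d → ℤ => ∏ i, w (x i) := by
  induction d with
  | zero => exact Summable.of_finite
  | succ d ih =>
    rw [← (Fin.consEquiv fun _ : Fin (d + 1) => ℤ).summable_iff]
    have h := hs.mul_of_nonneg ih hw (fun x => Finset.prod_nonneg fun i _ => hw _)
    refine h.congr fun p => ?_
    simp [Function.comp, Fin.prod_univ_succ, Fin.consEquiv]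

/-- The quantity `|a|² + |r|² + (|a|² |r|² - (a · r)²)`, that is, trace plus determinant of the
Gram matrix of two vectors of `ℤ⁴`. -/
def gramSize (a r : Fin 4 → ℤ) : ℝ :=
  (∑ i, (a i : ℝ) ^ 2) + (∑ i, (r i : ℝ) ^ 2) +
    ((∑ i, (a i : ℝ) ^ 2) * (∑ i, (r i : ℝ) ^ 2) - (∑ i, (a i : ℝ) * r i) ^ 2)

theorem one_add_sub_round_sq_le (n : ℤ) (θ : ℝ) :
    1 + ((n - round θ : ℤ) : ℝ) ^ 2 ≤ 2 * (1 + (n - θ) ^ 2) := by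
  have h := abs_sub_round θ
  push_cast
  have h2 : (θ - round θ) ^ 2 ≤ 1 / 4 := by
    rw [← sq_abs]; nlinarith [abs_nonneg (θ - round θ)]
  nlinarith [sq_nonneg ((n - θ) - (θ - round θ))]

/-- Lagrange's identity bounds the Gram determinant below by each of the squared minors that
involve two fixed coordinates. -/
theorem gramSize_ge {i j : Fin 4} (hij : i ≠ j) (a r : Fin 4 → ℤ) :
    (a i : ℝ) ^ 2 + (r i : ℝ) ^ 2 + ((a i : ℝ) * r j - a j * r i) ^ 2 ≤ gramSize a r := by
  have key : gramSize a r = (∑ i, (a i : ℝ) ^ 2) + (∑ i, (r i : ℝ) ^ 2) +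
      (((a 0 : ℝ) * r 1 - a 1 * r 0) ^ 2 + ((a 0 : ℝ) * r 2 - a 2 * r 0) ^ 2 +
      ((a 0 : ℝ) * r 3 - a 3 * r 0) ^ 2 + ((a 1 : ℝ) * r 2 - a 2 * r 1) ^ 2 +
      ((a 1 : ℝ) * r 3 - a 3 * r 1) ^ 2 + ((a 2 : ℝ) * r 3 - a 3 * r 2) ^ 2) := by
    simp only [gramSize, Fin.sum_univ_four]; ring
  rw [key]
  simp only [Fin.sum_univ_four]
  have h0 := fun x : Fin 4 => sq_nonneg (a x : ℝ)
  have h1 := fun x : Fin 4 => sq_nonneg (r x : ℝ)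
  have h2 := fun x y : Fin 4 => sq_nonneg ((a x : ℝ) * r y - a y * r x)
  have hs := fun x y : Fin 4 => show ((a x : ℝ) * r y - a y * r x) ^ 2 =
    ((a y : ℝ) * r x - a x * r y) ^ 2 by ring
  fin_cases i <;> fin_cases j <;> first | (exact absurd rfl hij) | skip
  all_goals
    simp only [Fin.zero_eta, Fin.mk_one, Fin.reduceFinMk]
    linarith [h0 0, h0 1, h0 2, h0 3, h1 0, h1 1, h1 2, h1 3, h2 0 1, h2 0 2, h2 0 3, h2 1 2,
      h2 1 3, h2 2 3, hs 0 1, hs 0 2, hs 0 3, hs 1 2, hs 1 3, hs 2 3]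

theorem gramSize_nonneg (a r : Fin 4 → ℤ) : 0 ≤ gramSize a r :=
  le_trans (by positivity) (gramSize_ge (by decide : (0 : Fin 4) ≠ 1) a r)

/-- The coordinates `(a, r_i, m_j, m_k)` with `m_j = r_j - round (a_j r_i / a_i)`. Subtracting the
rounded quotient makes `1 + m_j²` comparable to `1 + (r_j - a_j r_i / a_i)²`, and
`a_i (r_j - a_j r_i / a_i)` is a minor of the two vectors. -/
def latticeCoord (i j k : Fin 4) (p : (Fin 4 → ℤ) × (Fin 4 → ℤ)) : Fin 7 → ℤ :=
  ![p.1 0, p.1 1, p.1 2, p.1 3, p.2 i,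
    p.2 j - round ((p.1 j : ℝ) * p.2 i / p.1 i), p.2 k - round ((p.1 k : ℝ) * p.2 i / p.1 i)]

theorem rpow_sixFifths_pow_five {x : ℝ} (hx : 0 ≤ x) : (x ^ (6 / 5 : ℝ)) ^ 5 = x ^ 6 := by
  rw [← Real.rpow_natCast, ← Real.rpow_mul hx, ← Real.rpow_natCast]; norm_num

/-- The weight of the coordinates of `(a, r)` dominates `(gramSize a r)⁻³`, provided that `a i` is
a coordinate of `a` of maximal absolute value: with the minors at `(i, j)` and `(i, k)` one gets
`(gramSize a r)³ ≥ a_i⁴ (a_i² + r_i²) (1 + m_j²) (1 + m_k²) / 4`. -/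
theorem gramSize_inv_le {i j k : Fin 4} (hij : i ≠ j) (hik : i ≠ k) {a r : Fin 4 → ℤ}
    (hai : a i ≠ 0) (hmax : ∀ t, |a t| ≤ |a i|) :
    (gramSize a r ^ 3)⁻¹ ≤ 2 ^ 10 * ∏ t, latticeWeight (latticeCoord i j k (a, r) t) := by
  set A : ℝ := |(a i : ℝ)| with hA
  have hA1 : 1 ≤ A := by
    rw [hA]; exact_mod_cast Int.one_le_abs hai
  have hA0 : (a i : ℝ) ≠ 0 := by exact_mod_cast hai
  set R : ℝ := |(r i : ℝ)| with hR
  have hR0 : 0 ≤ R := abs_nonneg _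
  set mj : ℤ := r j - round ((a j : ℝ) * r i / a i) with hmj
  set mk : ℤ := r k - round ((a k : ℝ) * r i / a i) with hmk
  have hA2 : (a i : ℝ) ^ 2 = A ^ 2 := (sq_abs _).symm
  have hR2 : (r i : ℝ) ^ 2 = R ^ 2 := (sq_abs _).symm
  have minor (t : Fin 4) (hit : i ≠ t) :
      A ^ 2 * (1 + ((r t - round ((a t : ℝ) * r i / a i) : ℤ) : ℝ) ^ 2) ≤ 2 * gramSize a r := by
    have h1 := gramSize_ge hit a r
    have h2 := one_add_sub_round_sq_le (r t) ((a t : ℝ) * r i / a i)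
    have h3 : ((a i : ℝ) * r t - a t * r i) ^ 2 = A ^ 2 * (r t - (a t : ℝ) * r i / a i) ^ 2 := by
      rw [← hA2]; field_simp
    rw [h3, hA2] at h1
    nlinarith [sq_nonneg A, sq_nonneg (r i : ℝ)]
  have hj := minor j hij
  have hk := minor k hik
  have hi : A ^ 2 + R ^ 2 ≤ gramSize a r := by
    have := gramSize_ge hij a r
    rw [hA2, hR2] at this
    nlinarith [sq_nonneg ((a i : ℝ) * r j - a j * r i)]
  set g := gramSize a r
  have hcube : A ^ 4 * (A ^ 2 + R ^ 2) * ((1 + (mj : ℝ) ^ 2) * (1 + (mk : ℝ) ^ 2)) ≤ 4 * g ^ 3 := by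
    have h0 : 0 ≤ g := by nlinarith
    calc _ = (A ^ 2 * (1 + (mj : ℝ) ^ 2)) * (A ^ 2 * (1 + (mk : ℝ) ^ 2)) * (A ^ 2 + R ^ 2) := by
          ring
      _ ≤ (2 * g) * (2 * g) * g := by gcongr
      _ = _ := by ring
  have w_sq (m : ℤ) : (1 + |(m : ℝ)|) ^ (6 / 5 : ℝ) ≤ 2 * (1 + (m : ℝ) ^ 2) := by
    have h1 : (1 : ℝ) ≤ 1 + |(m : ℝ)| := by linarith [abs_nonneg (m : ℝ)]
    calc (1 + |(m : ℝ)|) ^ (6 / 5 : ℝ) ≤ (1 + |(m : ℝ)|) ^ (2 : ℝ) :=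
          Real.rpow_le_rpow_of_exponent_le h1 (by norm_num)
      _ = (1 + |(m : ℝ)|) ^ 2 := by norm_cast
      _ ≤ _ := by rw [← sq_abs (m : ℝ)]; nlinarith [sq_nonneg (1 - |(m : ℝ)|)]
  -- the five remaining weights are compared through their fifth powers
  have hfive : (1 + |(a 0 : ℝ)|) ^ (6 / 5 : ℝ) * (1 + |(a 1 : ℝ)|) ^ (6 / 5 : ℝ) *
      (1 + |(a 2 : ℝ)|) ^ (6 / 5 : ℝ) * (1 + |(a 3 : ℝ)|) ^ (6 / 5 : ℝ) *
      (1 + R) ^ (6 / 5 : ℝ) ≤ 2 ^ 6 * (A ^ 4 * (A ^ 2 + R ^ 2)) := by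
    have hb (t : Fin 4) : 1 + |(a t : ℝ)| ≤ 2 * A := by
      have : |(a t : ℝ)| ≤ A := by rw [hA]; exact_mod_cast hmax t
      linarith
    apply le_of_pow_le_pow_left₀ (n := 5) (by norm_num) (by positivity)
    simp only [mul_pow _ _ 5]
    have hpow (t : Fin 4) : ((1 + |(a t : ℝ)|) ^ (6 / 5 : ℝ)) ^ 5 = (1 + |(a t : ℝ)|) ^ 6 :=
      rpow_sixFifths_pow_five (by positivity)
    simp only [hpow, rpow_sixFifths_pow_five (by positivity : (0 : ℝ) ≤ 1 + R)]
    have hAR : (1 + R) ^ 2 ≤ 4 * (A ^ 2 + R ^ 2) := by nlinarith [sq_nonneg (1 - R)]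
    have hAA : A ^ 2 ≤ A ^ 2 + R ^ 2 := by nlinarith
    calc (1 + |(a 0 : ℝ)|) ^ 6 * (1 + |(a 1 : ℝ)|) ^ 6 * (1 + |(a 2 : ℝ)|) ^ 6 *
          (1 + |(a 3 : ℝ)|) ^ 6 * (1 + R) ^ 6
        ≤ (2 * A) ^ 6 * (2 * A) ^ 6 * (2 * A) ^ 6 * (2 * A) ^ 6 * (1 + R) ^ 6 := by
          gcongr <;> exact hb _
      _ = 2 ^ 24 * A ^ 20 * (A ^ 2) ^ 2 * ((1 + R) ^ 2) ^ 3 := by ring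
      _ ≤ 2 ^ 24 * A ^ 20 * (A ^ 2 + R ^ 2) ^ 2 * (4 * (A ^ 2 + R ^ 2)) ^ 3 := by gcongr
      _ = (2 ^ 6) ^ 5 * ((A ^ 4) ^ 5 * (A ^ 2 + R ^ 2) ^ 5) := by ring
  have hprod : ∏ t, latticeWeight (latticeCoord i j k (a, r) t) =
      ((1 + |(a 0 : ℝ)|) ^ (6 / 5 : ℝ) * (1 + |(a 1 : ℝ)|) ^ (6 / 5 : ℝ) *
      (1 + |(a 2 : ℝ)|) ^ (6 / 5 : ℝ) * (1 + |(a 3 : ℝ)|) ^ (6 / 5 : ℝ) *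
      (1 + R) ^ (6 / 5 : ℝ) * ((1 + |(mj : ℝ)|) ^ (6 / 5 : ℝ) *
      (1 + |(mk : ℝ)|) ^ (6 / 5 : ℝ)))⁻¹ := by
    have hw (n : ℤ) : latticeWeight n = ((1 + |(n : ℝ)|) ^ (6 / 5 : ℝ))⁻¹ := by
      unfold latticeWeight; rw [Real.rpow_neg (by positivity)]
    simp only [hw, Finset.prod_inv_distrib]
    congr 1
    simp only [Fin.prod_univ_succ, latticeCoord, hmj, hmk, hR]
    simp
    ring
  rw [hprod, ← div_eq_mul_inv, inv_eq_one_div, div_le_div_iff₀ (pow_pos (by nlinarith) 3)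
    (by positivity), one_mul]
  calc _ ≤ 2 ^ 6 * (A ^ 4 * (A ^ 2 + R ^ 2)) *
        ((2 * (1 + (mj : ℝ) ^ 2)) * (2 * (1 + (mk : ℝ) ^ 2))) := by
        gcongr
        · exact w_sq mj
        · exact w_sq mk
    _ = 2 ^ 8 * (A ^ 4 * (A ^ 2 + R ^ 2) * ((1 + (mj : ℝ) ^ 2) * (1 + (mk : ℝ) ^ 2))) := by ring
    _ ≤ 2 ^ 8 * (4 * g ^ 3) := by gcongr
    _ = _ := by ring

/-- The pairs `(a, r)` of vectors of `ℤ⁴` that are orthogonal for the standard symplectic form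
`a₀ r₂ + a₁ r₃ - a₂ r₀ - a₃ r₁`, with `a ≠ 0`. -/
def isotropicPairs : Set ((Fin 4 → ℤ) × (Fin 4 → ℤ)) :=
  {p | p.1 ≠ 0 ∧ p.1 0 * p.2 2 + p.1 1 * p.2 3 - p.1 2 * p.2 0 - p.1 3 * p.2 1 = 0}

/-- Given `a` with `a i ≠ 0`, the orthogonality relation determines the coordinate of `r` that is
paired with `r i` (of index `i + 2`) from the other three. -/
theorem latticeCoord_injOn (i : Fin 4) :
    Set.InjOn (latticeCoord i (i + 1) (i + 3)) {p ∈ isotropicPairs | p.1 i ≠ 0} := by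
  rintro ⟨a, r⟩ ⟨⟨-, h1⟩, hi⟩ ⟨a', r'⟩ ⟨⟨-, h2⟩, -⟩ h
  have e0 := congrFun h 0
  have e1 := congrFun h 1
  have e2 := congrFun h 2
  have e3 := congrFun h 3
  have e4 := congrFun h 4
  have e5 := congrFun h 5
  have e6 := congrFun h 6
  simp only [latticeCoord, Matrix.cons_val] at e0 e1 e2 e3 e4 e5 e6
  obtain rfl : a = a' := by ext t; fin_cases t <;> assumption
  rw [e4] at e5 e6
  replace e5 := sub_left_injective e5
  replace e6 := sub_left_injective e6
  simp only at h1 h2 hi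
  have e7 : a i * (r (i + 2) - r' (i + 2)) = 0 := by
    fin_cases i <;> simp [-mul_eq_zero] at e4 e5 e6 ⊢ <;> rw [e4, e5, e6] at h1 <;>
      first | linear_combination h1 - h2 | linear_combination h2 - h1
  have e8 : r (i + 2) = r' (i + 2) := by
    rcases mul_eq_zero.mp e7 with h | h
    · exact absurd h hi
    · omega
  have : r = r' := by
    ext t
    fin_cases i <;> fin_cases t <;> assumption
  rw [this]

/-- The sum of `(tr Q + det Q)⁻³` over the Gram matrices `Q` of isotropic pairs converges. The pairs
are split according to the position of a coordinate of `a` of maximal absolute value. -/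
theorem summable_gramSize_inv :
    Summable fun p : isotropicPairs => (gramSize p.1.1 p.1.2 ^ 3)⁻¹ := by
  set S : Fin 4 → Set ((Fin 4 → ℤ) × (Fin 4 → ℤ)) :=
    fun i => {p ∈ isotropicPairs | p.1 i ≠ 0 ∧ ∀ t, |p.1 t| ≤ |p.1 i|}
  set f : (Fin 4 → ℤ) × (Fin 4 → ℤ) → ℝ := fun p => (gramSize p.1 p.2 ^ 3)⁻¹ with hf
  have hf0 : ∀ p, 0 ≤ f p := fun p => inv_nonneg.mpr (pow_nonneg (gramSize_nonneg _ _) 3)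
  have hS (i : Fin 4) : Summable ((S i).indicator f) := by
    rw [← summable_subtype_iff_indicator]
    have hinj : Function.Injective fun p : S i => latticeCoord i (i + 1) (i + 3) p.1 := by
      intro p q hpq
      exact Subtype.ext (latticeCoord_injOn i ⟨p.2.1, p.2.2.1⟩ ⟨q.2.1, q.2.2.1⟩ hpq)
    have hw := ((summable_prod_pi latticeWeight_nonneg summable_latticeWeight 7).comp_injective
      hinj).mul_left (2 ^ 10)
    refine Summable.of_nonneg_of_le (fun p => hf0 _) (fun p => ?_) hw
    have hi1 : i ≠ i + 1 := by fin_cases i <;> decide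
    have hi3 : i ≠ i + 3 := by fin_cases i <;> decide
    exact gramSize_inv_le hi1 hi3 p.2.2.1 p.2.2.2
  have hsum := summable_sum (s := Finset.univ) fun i _ => hS i
  refine Summable.of_nonneg_of_le (fun p => hf0 _) (fun p => ?_)
    (hsum.comp_injective (Subtype.val_injective (p := (· ∈ isotropicPairs))))
  obtain ⟨i, -, hi⟩ :=
    Finset.exists_max_image Finset.univ (fun t => |p.1.1 t|) ⟨0, Finset.mem_univ _⟩
  have hne : p.1.1 i ≠ 0 := by
    intro h0
    refine p.2.1 (funext fun t => ?_)
    have := hi t (Finset.mem_univ _)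
    rw [h0, abs_zero] at this
    exact abs_nonpos_iff.mp this
  have hmem : p.1 ∈ S i := ⟨p.2, hne, fun t => hi t (Finset.mem_univ _)⟩
  calc f p.1 = (S i).indicator f p.1 := (Set.indicator_of_mem hmem f).symm
    _ ≤ ∑ i, (S i).indicator f p.1 :=
      Finset.single_le_sum (f := fun i => (S i).indicator f p.1)
        (fun i _ => Set.indicator_nonneg (fun _ _ => hf0 _) _) (Finset.mem_univ i)
    _ = _ := by simp

/-! ### The symplectic action on the upper half-space -/

/-- The matrix `C Z + D`, whose determinant is the factor of automorphy. -/
def autoFactor (M : Gam) (Z : Matrix (Fin 2) (Fin 2) ℂ) : Matrix (Fin 2) (Fin 2) ℂ :=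
  blockC M * Z + blockD M

/-- The matrix `A Z + B`, so that `M • Z = (A Z + B) (C Z + D)⁻¹`. -/
def autoNum (M : Gam) (Z : Matrix (Fin 2) (Fin 2) ℂ) : Matrix (Fin 2) (Fin 2) ℂ :=
  blockA M * Z + blockB M

theorem intCast_matrix_mul (A B : Matrix (Fin 2) (Fin 2) ℤ) :
    (A * B).map (Int.cast : ℤ → ℂ) = A.map Int.cast * B.map Int.cast :=
  Matrix.map_mul (f := Int.castRingHom ℂ)

theorem block_relations (M : Gam) :
    (blockA M)ᵀ * blockC M = (blockC M)ᵀ * blockA M ∧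
    (blockB M)ᵀ * blockD M = (blockD M)ᵀ * blockB M ∧
    (blockA M)ᵀ * blockD M = 1 + (blockC M)ᵀ * blockB M := by
  have h := M.2
  rw [← fromBlocks_toBlocks M.1, SymplecticGroup.fromBlocks_mem_iff] at h
  obtain ⟨h1, h2, h3⟩ := h
  have cast (A B : Matrix (Fin 2) (Fin 2) ℤ) :=
    (intCast_matrix_mul Aᵀ B)
  refine ⟨?_, ?_, ?_⟩
  · have := congrArg (fun A => A.map (Int.cast : ℤ → ℂ)) h1
    simp only [cast] at this
    exact this
  · have := congrArg (fun A => A.map (Int.cast : ℤ → ℂ)) h2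
    simp only [cast] at this
    exact this
  · rw [sub_eq_iff_eq_add] at h3
    have := congrArg (fun A => A.map (Int.cast : ℤ → ℂ)) h3
    simp only [cast] at this
    rw [Matrix.map_add _ (by simp), cast, Matrix.map_one _ (by simp) (by simp)] at this
    exact this

theorem conjTranspose_map_intCast (A : Matrix (Fin 2) (Fin 2) ℤ) :
    (A.map (Int.cast : ℤ → ℂ))ᴴ = (A.map (Int.cast : ℤ → ℂ))ᵀ := by
  ext i j; simp

theorem autoFactor_transpose_mul_autoNum (M : Gam) {Z : Matrix (Fin 2) (Fin 2) ℂ}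
    (hZ : Z.IsSymm) : (autoFactor M Z)ᵀ * autoNum M Z = (autoNum M Z)ᵀ * autoFactor M Z := by
  obtain ⟨h1, h2, h3⟩ := block_relations M
  have h4 := congrArg Matrix.transpose h3
  simp only [transpose_mul, transpose_transpose, transpose_add, transpose_one] at h4
  simp only [autoFactor, autoNum, transpose_add, transpose_mul, hZ.eq, Matrix.add_mul,
    Matrix.mul_add]
  simp only [Matrix.mul_assoc]
  rw [h2, h3, ← Matrix.mul_assoc _ _ Z, ← Matrix.mul_assoc _ (blockA M) Z, ← h1, h4]
  noncomm_ring

theorem autoFactor_conjTranspose_mul_autoNum (M : Gam) (Z : Matrix (Fin 2) (Fin 2) ℂ) :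
    (autoFactor M Z)ᴴ * autoNum M Z - (autoNum M Z)ᴴ * autoFactor M Z = Z - Zᴴ := by
  obtain ⟨h1, h2, h3⟩ := block_relations M
  have h4 := congrArg Matrix.transpose h3
  simp only [transpose_mul, transpose_transpose, transpose_add, transpose_one] at h4
  have hA : (blockA M)ᴴ = (blockA M)ᵀ := conjTranspose_map_intCast _
  have hB : (blockB M)ᴴ = (blockB M)ᵀ := conjTranspose_map_intCast _
  have hC : (blockC M)ᴴ = (blockC M)ᵀ := conjTranspose_map_intCast _
  have hD : (blockD M)ᴴ = (blockD M)ᵀ := conjTranspose_map_intCast _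
  simp only [autoFactor, autoNum, conjTranspose_add, conjTranspose_mul, hA, hB, hC, hD,
    Matrix.add_mul, Matrix.mul_add]
  simp only [Matrix.mul_assoc]
  rw [h2, h3, ← Matrix.mul_assoc _ _ Z, ← Matrix.mul_assoc _ (blockC M) Z, h1,
    ← Matrix.mul_assoc (blockD M)ᵀ, h4]
  noncomm_ring

theorem sub_conjTranspose_of_isSymm {W : Matrix (Fin 2) (Fin 2) ℂ} (hW : W.IsSymm) :
    W - Wᴴ = (2 * I) • (W.map Complex.im).map Complex.ofReal := by
  ext i j
  rw [Matrix.sub_apply, conjTranspose_apply, hW.apply, Matrix.smul_apply, map_apply, map_apply]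
  exact (Complex.sub_conj _).trans (by rw [hW.apply]; simp; ring)

theorem quadForm_pos {S : Matrix (Fin 2) (Fin 2) ℝ} (hS : S.PosDef) {x y : ℝ}
    (h : ¬ (x = 0 ∧ y = 0)) : 0 < S 0 0 * x ^ 2 + 2 * S 0 1 * x * y + S 1 1 * y ^ 2 := by
  have h10 : S 1 0 = S 0 1 := by simpa using (hS.isHermitian.apply 0 1)
  have := hS.dotProduct_mulVec_pos (x := ![x, y]) (by
    intro h0
    exact h ⟨by simpa using congrFun h0 0, by simpa using congrFun h0 1⟩)
  simp [dotProduct, mulVec, Fin.sum_univ_two, h10] at this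
  linarith

/-- `C Z + D` is invertible: a null vector `v` would satisfy `vᴴ Y v = 0`. -/
theorem autoFactor_det_ne_zero (M : Gam) {Z : Matrix (Fin 2) (Fin 2) ℂ}
    (hZ : Z ∈ siegelUpperHalfSpace) : (autoFactor M Z).det ≠ 0 := by
  intro h0
  obtain ⟨v, hv, hJv⟩ := exists_mulVec_eq_zero_iff.mpr h0
  have hs : Z 1 0 = Z 0 1 := hZ.1.apply 0 1
  have h1 : star v ⬝ᵥ ((Z - Zᴴ) *ᵥ v) = 0 := by
    have hl : star v ᵥ* (autoFactor M Z)ᴴ = 0 := by rw [← star_mulVec, hJv, star_zero]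
    rw [← autoFactor_conjTranspose_mul_autoNum M Z, sub_mulVec, ← mulVec_mulVec, ← mulVec_mulVec,
      hJv, mulVec_zero, sub_zero, dotProduct_mulVec, hl, zero_dotProduct]
  rw [sub_conjTranspose_of_isSymm hZ.1, smul_mulVec, dotProduct_smul, smul_eq_mul,
    mul_eq_zero, or_iff_right (by simp)] at h1
  have h2 := congrArg Complex.re h1
  simp [dotProduct, mulVec, Fin.sum_univ_two, hs] at h2
  have hre := quadForm_pos hZ.2 (x := (v 0).re) (y := (v 1).re)
  have him := quadForm_pos hZ.2 (x := (v 0).im) (y := (v 1).im)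
  simp only [map_apply] at hre him
  by_cases c1 : (v 0).re = 0 ∧ (v 1).re = 0
  · by_cases c2 : (v 0).im = 0 ∧ (v 1).im = 0
    · refine hv (funext fun i => ?_)
      fin_cases i
      · exact Complex.ext c1.1 c2.1
      · exact Complex.ext c1.2 c2.2
    · have := him c2
      rw [c1.1, c1.2] at h2
      nlinarith
  · have := hre c1
    by_cases c2 : (v 0).im = 0 ∧ (v 1).im = 0
    · rw [c2.1, c2.2] at h2
      nlinarith
    · have := him c2
      nlinarith

theorem act_isSymm (M : Gam) {Z : Matrix (Fin 2) (Fin 2) ℂ} (hZ : Z ∈ siegelUpperHalfSpace) :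
    (act M Z).IsSymm := by
  have hu : IsUnit (autoFactor M Z).det := Ne.isUnit (autoFactor_det_ne_zero M hZ)
  have hut : IsUnit (autoFactor M Z)ᵀ.det := by rwa [det_transpose]
  have h := autoFactor_transpose_mul_autoNum M hZ.1
  change (autoNum M Z * (autoFactor M Z)⁻¹)ᵀ = autoNum M Z * (autoFactor M Z)⁻¹
  rw [transpose_mul, transpose_nonsing_inv]
  calc ((autoFactor M Z)ᵀ)⁻¹ * (autoNum M Z)ᵀ
      = ((autoFactor M Z)ᵀ)⁻¹ * ((autoNum M Z)ᵀ * autoFactor M Z) * (autoFactor M Z)⁻¹ := by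
        rw [Matrix.mul_assoc, Matrix.mul_assoc, mul_nonsing_inv _ hu, Matrix.mul_one]
    _ = _ := by rw [← h, ← Matrix.mul_assoc, nonsing_inv_mul _ hut, Matrix.one_mul]

/-- The transformation law of the imaginary part: `Jᴴ Im(M • Z) J = Im Z` with `J = C Z + D`. -/
theorem im_act (M : Gam) {Z : Matrix (Fin 2) (Fin 2) ℂ} (hZ : Z ∈ siegelUpperHalfSpace) :
    (autoFactor M Z)ᴴ * ((act M Z).map Complex.im).map Complex.ofReal * autoFactor M Z =
      (Z.map Complex.im).map Complex.ofReal := by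
  have hu : IsUnit (autoFactor M Z).det := Ne.isUnit (autoFactor_det_ne_zero M hZ)
  have huc : IsUnit (autoFactor M Z)ᴴ.det := by rw [det_conjTranspose]; exact hu.star
  have h := autoFactor_conjTranspose_mul_autoNum M Z
  have hN : act M Z * autoFactor M Z = autoNum M Z := by
    change autoNum M Z * (autoFactor M Z)⁻¹ * autoFactor M Z = _
    rw [Matrix.mul_assoc, nonsing_inv_mul _ hu, Matrix.mul_one]
  have h2 : (autoFactor M Z)ᴴ * (act M Z - (act M Z)ᴴ) * autoFactor M Z = Z - Zᴴ := by
    rw [← h, ← hN, conjTranspose_mul]; noncomm_ring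
  rw [sub_conjTranspose_of_isSymm (act_isSymm M hZ), sub_conjTranspose_of_isSymm hZ.1,
    Matrix.mul_smul, Matrix.smul_mul] at h2
  exact smul_right_injective _ (by simp : (2 * I : ℂ) ≠ 0) h2

theorem det_map_ofReal (S : Matrix (Fin 2) (Fin 2) ℝ) :
    (S.map Complex.ofReal).det = (S.det : ℂ) := by
  simp [det_fin_two]

theorem star_mul_self_eq_norm_sq (z : ℂ) : star z * z = ((‖z‖ ^ 2 : ℝ) : ℂ) := by
  rw [ofReal_pow]
  exact Complex.conj_mul' z

theorem det_im_act (M : Gam) {Z : Matrix (Fin 2) (Fin 2) ℂ} (hZ : Z ∈ siegelUpperHalfSpace) :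
    ‖(autoFactor M Z).det‖ ^ 2 * ((act M Z).map Complex.im).det = (Z.map Complex.im).det := by
  have h := congrArg Matrix.det (im_act M hZ)
  rw [det_mul, det_mul, det_conjTranspose, det_map_ofReal, det_map_ofReal] at h
  have h3 := star_mul_self_eq_norm_sq (autoFactor M Z).det
  apply Complex.ofReal_injective
  rw [ofReal_mul, ← h3, ← h]; ring

theorem adjugate_im_act (M : Gam) {Z : Matrix (Fin 2) (Fin 2) ℂ} (hZ : Z ∈ siegelUpperHalfSpace) :
    autoFactor M Z * ((Z.map Complex.im).map Complex.ofReal).adjugate * (autoFactor M Z)ᴴ =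
      ((‖(autoFactor M Z).det‖ ^ 2 : ℝ) : ℂ) •
        (((act M Z).map Complex.im).map Complex.ofReal).adjugate := by
  have h3 := star_mul_self_eq_norm_sq (autoFactor M Z).det
  rw [← im_act M hZ, adjugate_mul_distrib, adjugate_mul_distrib, ← Matrix.mul_assoc,
    mul_adjugate, Matrix.smul_mul, Matrix.one_mul, Matrix.smul_mul, Matrix.mul_assoc,
    adjugate_mul, Matrix.mul_smul, Matrix.mul_one, smul_smul, det_conjTranspose, ← h3, mul_comm]

/-! ### Bottom rows -/

/-- The row `(c, d)` of index `t` of the lower half `(C D)` of a symplectic matrix. -/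
def bottomRow (M : Gam) (t : Fin 2) : Fin 4 → ℤ :=
  ![M.1 (Sum.inr t) (Sum.inl 0), M.1 (Sum.inr t) (Sum.inl 1),
    M.1 (Sum.inr t) (Sum.inr 0), M.1 (Sum.inr t) (Sum.inr 1)]

/-- The quadratic form `v = (c, d) ↦ det Y · (c Z + d) Y⁻¹ (c Z + d)ᴴ` on `ℝ⁴`, for `Z = X + i Y`,
written as `p · adj Y · pᵀ + det Y · (c Y cᵀ)` with `p = c X + d`. -/
def siegelForm (Z : Matrix (Fin 2) (Fin 2) ℂ) (v : Fin 4 → ℝ) : ℝ :=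
  (Z 1 1).im * (v 0 * (Z 0 0).re + v 1 * (Z 0 1).re + v 2) ^ 2
    - 2 * (Z 0 1).im * (v 0 * (Z 0 0).re + v 1 * (Z 0 1).re + v 2) *
      (v 0 * (Z 0 1).re + v 1 * (Z 1 1).re + v 3)
    + (Z 0 0).im * (v 0 * (Z 0 1).re + v 1 * (Z 1 1).re + v 3) ^ 2
    + ((Z 0 0).im * (Z 1 1).im - (Z 0 1).im ^ 2) *
      ((Z 0 0).im * v 0 ^ 2 + 2 * (Z 0 1).im * v 0 * v 1 + (Z 1 1).im * v 1 ^ 2)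

/-- In terms of the bottom rows, the quadratic form of `|det J|² adj (Im (M • Z))` is the form of
`Z` pulled back along `x ↦ x (C D)`. -/
theorem siegelForm_bottomRow (M : Gam) {Z : Matrix (Fin 2) (Fin 2) ℂ}
    (hZ : Z ∈ siegelUpperHalfSpace) (x y : ℝ) :
    siegelForm Z (fun i => x * bottomRow M 0 i + y * bottomRow M 1 i) =
      ‖(autoFactor M Z).det‖ ^ 2 * ((act M Z 1 1).im * x ^ 2 - 2 * (act M Z 0 1).im * x * y +
        (act M Z 0 0).im * y ^ 2) := by
  have hs : Z 1 0 = Z 0 1 := hZ.1.apply 0 1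
  have hW : act M Z 1 0 = act M Z 0 1 := (act_isSymm M hZ).apply 0 1
  have h := adjugate_im_act M hZ
  set δ := ‖(autoFactor M Z).det‖ ^ 2
  have h00 := congrFun (congrFun h 0) 0
  have h01 := congrFun (congrFun h 0) 1
  have h10 := congrFun (congrFun h 1) 0
  have h11 := congrFun (congrFun h 1) 1
  set J := autoFactor M Z with hJ
  simp only [Matrix.mul_apply, Fin.sum_univ_two, adjugate_fin_two, conjTranspose_apply,
    Matrix.smul_apply, map_apply, smul_eq_mul, hs, hW, of_apply, cons_val', cons_val_zero,
    cons_val_one, RCLike.star_def] at h00 h01 h10 h11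
  -- the row vector `z = (x, y) J`, with real part `p` and imaginary part `q`
  obtain ⟨z0, hz0⟩ : ∃ z, z = x * J 0 0 + y * J 1 0 := ⟨_, rfl⟩
  obtain ⟨z1, hz1⟩ : ∃ z, z = x * J 0 1 + y * J 1 1 := ⟨_, rfl⟩
  have hz0c : (starRingEnd ℂ) z0 = x * (starRingEnd ℂ) (J 0 0) + y * (starRingEnd ℂ) (J 1 0) := by
    rw [hz0]; simp
  have hz1c : (starRingEnd ℂ) z1 = x * (starRingEnd ℂ) (J 0 1) + y * (starRingEnd ℂ) (J 1 1) := by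
    rw [hz1]; simp
  have hform : (Z 1 1).im * (z0 * (starRingEnd ℂ) z0) - (Z 0 1).im * (z0 * (starRingEnd ℂ) z1 +
      z1 * (starRingEnd ℂ) z0) + (Z 0 0).im * (z1 * (starRingEnd ℂ) z1) =
      ((δ * ((act M Z 1 1).im * x ^ 2 - 2 * (act M Z 0 1).im * x * y +
        (act M Z 0 0).im * y ^ 2) : ℝ) : ℂ) := by
    rw [hz0c, hz1c, hz0, hz1]
    push_cast
    linear_combination (x : ℂ) ^ 2 * h00 + x * y * h01 + x * y * h10 + (y : ℂ) ^ 2 * h11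
  rw [← Complex.ofReal_injective.eq_iff, ← hform]
  have hJe (t j : Fin 2) : J t j = (M.1 (Sum.inr t) (Sum.inl 0) : ℂ) * Z 0 j +
      (M.1 (Sum.inr t) (Sum.inl 1) : ℂ) * Z 1 j + (M.1 (Sum.inr t) (Sum.inr j) : ℂ) := by
    simp [hJ, autoFactor, blockC, blockD, Matrix.mul_apply, Fin.sum_univ_two, toBlocks₂₁,
      toBlocks₂₂]
  have hre0 : z0.re = (x * bottomRow M 0 0 + y * bottomRow M 1 0) * (Z 0 0).re +
      (x * bottomRow M 0 1 + y * bottomRow M 1 1) * (Z 0 1).re +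
      (x * bottomRow M 0 2 + y * bottomRow M 1 2) := by
    rw [hz0, hJe, hJe, hs]; simp [bottomRow]; ring
  have hre1 : z1.re = (x * bottomRow M 0 0 + y * bottomRow M 1 0) * (Z 0 1).re +
      (x * bottomRow M 0 1 + y * bottomRow M 1 1) * (Z 1 1).re +
      (x * bottomRow M 0 3 + y * bottomRow M 1 3) := by
    rw [hz1, hJe, hJe]; simp [bottomRow]; ring
  have him0 : z0.im = (x * bottomRow M 0 0 + y * bottomRow M 1 0) * (Z 0 0).im +
      (x * bottomRow M 0 1 + y * bottomRow M 1 1) * (Z 0 1).im := by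
    rw [hz0, hJe, hJe, hs]; simp [bottomRow]; ring
  have him1 : z1.im = (x * bottomRow M 0 0 + y * bottomRow M 1 0) * (Z 0 1).im +
      (x * bottomRow M 0 1 + y * bottomRow M 1 1) * (Z 1 1).im := by
    rw [hz1, hJe, hJe]; simp [bottomRow]; ring
  unfold siegelForm
  rw [← hre0, ← hre1]
  apply Complex.ext
  · simp only [ofReal_re, add_re, sub_re, mul_re, conj_re, conj_im, ofReal_im, add_im, mul_im]
    rw [him0, him1]
    ring
  · simp only [ofReal_im, add_re, sub_im, mul_re, conj_re, conj_im, ofReal_re, add_im, mul_im]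
    ring

/-- The bottom rows of a symplectic matrix are orthogonal, and the first one is non-zero. -/
theorem bottomRow_mem_isotropicPairs (M : Gam) :
    (bottomRow M 0, bottomRow M 1) ∈ isotropicPairs := by
  have h := SymplecticGroup.mem_iff.mp M.2
  constructor
  · intro h0
    have hdet := SymplecticGroup.symplectic_det M.2
    rw [det_eq_zero_of_row_eq_zero (Sum.inr 0)] at hdet
    · simp at hdet
    · rintro (j | j) <;> fin_cases j
      · exact congrFun h0 0
      · exact congrFun h0 1
      · exact congrFun h0 2
      · exact congrFun h0 3
  · have h01 := congrFun (congrFun h (Sum.inr 0)) (Sum.inr 1)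
    simp [J, Matrix.mul_apply, Fintype.sum_sum_type, Fin.sum_univ_two, fromBlocks,
      Matrix.one_apply] at h01
    simp [bottomRow]
    linarith

/-- `M N⁻¹` has the bottom rows of `N N⁻¹ = 1`, and a symplectic matrix with bottom rows `(0 1)` is
a translation. -/
theorem mul_inv_mem_translationSubgroup {M N : Gam} (h : ∀ t, bottomRow M t = bottomRow N t) :
    M * N⁻¹ ∈ translationSubgroup := by
  have hrow (t : Fin 2) (j : Fin 2 ⊕ Fin 2) : M.1 (Sum.inr t) j = N.1 (Sum.inr t) j := by
    rcases j with j | j <;> fin_cases j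
    · exact congrFun (h t) 0
    · exact congrFun (h t) 1
    · exact congrFun (h t) 2
    · exact congrFun (h t) 3
  have hrow' (t : Fin 2) (j : Fin 2 ⊕ Fin 2) :
      (M * N⁻¹).1 (Sum.inr t) j = (1 : Matrix (Fin 2 ⊕ Fin 2) (Fin 2 ⊕ Fin 2) ℤ) (Sum.inr t) j := by
    have h1 : (N * N⁻¹).1 = 1 := by rw [mul_inv_cancel]; rfl
    rw [← h1]
    simp only [Submonoid.coe_mul, Matrix.mul_apply, hrow]
  set P := M * N⁻¹
  have h21 : P.1.toBlocks₂₁ = 0 := by ext i j; simp [toBlocks₂₁, hrow']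
  have h22 : P.1.toBlocks₂₂ = 1 := by ext i j; simp [toBlocks₂₂, hrow', Matrix.one_apply]
  have hP := P.2
  rw [← fromBlocks_toBlocks P.1, SymplecticGroup.fromBlocks_mem_iff, h21, h22] at hP
  obtain ⟨-, h2, h3⟩ := hP
  have h11 : P.1.toBlocks₁₁ = 1 := by
    have := congrArg Matrix.transpose h3
    simpa using this
  refine ⟨P.1.toBlocks₁₂, ?_, ?_⟩
  · simpa [IsSymm] using h2
  · conv_lhs => rw [← fromBlocks_toBlocks P.1, h11, h21, h22]

/-- Cosets of the translation subgroup are determined by the bottom rows of a representative. -/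
theorem bottomRow_out_injective : Function.Injective fun q : Cosets =>
    (⟨(bottomRow q.out 0, bottomRow q.out 1), bottomRow_mem_isotropicPairs _⟩ :
      isotropicPairs) := by
  intro q q' h
  have h' := congrArg Subtype.val h
  have h0 := congrArg Prod.fst h'
  have h1 := congrArg Prod.snd h'
  rw [← Quotient.out_eq q, ← Quotient.out_eq q']
  symm
  apply Quotient.sound
  change QuotientGroup.rightRel _ _ _
  rw [QuotientGroup.rightRel_apply]
  exact mul_inv_mem_translationSubgroup (Fin.forall_fin_two.mpr ⟨h0, h1⟩)

/-! ### Binary quadratic forms -/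

theorem posDef_fin_two_iff {S : Matrix (Fin 2) (Fin 2) ℝ} :
    S.PosDef ↔ S 1 0 = S 0 1 ∧ 0 < S 0 0 ∧ 0 < S.det := by
  constructor
  · intro h
    exact ⟨by simpa using h.isHermitian.apply 0 1, h.diag_pos, h.det_pos⟩
  · rintro ⟨hs, h0, hd⟩
    rw [det_fin_two, hs] at hd
    refine .of_dotProduct_mulVec_pos ?_ fun x hx => ?_
    · ext i j
      fin_cases i <;> fin_cases j <;> simp [hs]
    · have e : star x ⬝ᵥ (S *ᵥ x) = S 0 0 * x 0 ^ 2 + 2 * S 0 1 * x 0 * x 1 + S 1 1 * x 1 ^ 2 := by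
        simp [dotProduct, mulVec, Fin.sum_univ_two, hs]; ring
      rw [e]
      have e2 : S 0 0 * (S 0 0 * x 0 ^ 2 + 2 * S 0 1 * x 0 * x 1 + S 1 1 * x 1 ^ 2) =
          (S 0 0 * x 0 + S 0 1 * x 1) ^ 2 + (S 0 0 * S 1 1 - S 0 1 * S 0 1) * x 1 ^ 2 := by ring
      refine pos_of_mul_pos_right (a := S 0 0) ?_ h0.le
      rw [e2]
      by_cases h1 : x 1 = 0
      · have hx0 : x 0 ≠ 0 := fun h => hx (funext fun i => by fin_cases i <;> assumption)
        simp only [h1, mul_zero, add_zero, zero_pow two_ne_zero]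
        have := sq_pos_of_ne_zero (mul_ne_zero h0.ne' hx0)
        linarith
      · have := mul_pos hd (sq_pos_of_ne_zero h1)
        linarith [sq_nonneg (S 0 0 * x 0 + S 0 1 * x 1)]

/-- Mixed discriminants of positive semidefinite binary quadratic forms are nonnegative. -/
theorem mixed_discriminant_nonneg {a b d a' b' d' : ℝ} (ha : 0 ≤ a) (hd : 0 ≤ d)
    (h : b ^ 2 ≤ a * d) (ha' : 0 ≤ a') (hd' : 0 ≤ d') (h' : b' ^ 2 ≤ a' * d') :
    0 ≤ a * d' + d * a' - 2 * b * b' := by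
  have h1 : (2 * b * b') ^ 2 ≤ (a * d' + d * a') ^ 2 := by
    calc (2 * b * b') ^ 2 = 4 * (b ^ 2 * b' ^ 2) := by ring
      _ ≤ 4 * ((a * d) * (a' * d')) := by gcongr
      _ ≤ _ := by nlinarith [sq_nonneg (a * d' - d * a')]
  linarith [le_abs_self (2 * b * b'), abs_le_of_sq_le_sq h1 (by positivity)]

theorem sq_le_mul_of_form_nonneg {a b d : ℝ}
    (h : ∀ x y : ℝ, 0 ≤ a * x ^ 2 - 2 * b * x * y + d * y ^ 2) :
    0 ≤ a ∧ 0 ≤ d ∧ b ^ 2 ≤ a * d := by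
  have ha : 0 ≤ a := by simpa using h 1 0
  have hd : 0 ≤ d := by simpa using h 0 1
  refine ⟨ha, hd, ?_⟩
  rcases ha.eq_or_lt with h0 | h0
  · subst h0
    by_contra hb
    have hb0 : b ≠ 0 := by rintro rfl; simp at hb
    have h1 := h ((d + 1) / (2 * b)) 1
    have h2 : 2 * b * ((d + 1) / (2 * b)) = d + 1 := by field_simp
    rw [h2] at h1
    linarith
  · -- completing the square: the minimum over `x` is attained at `b y / a`
    have h1 := h b a
    have h2 : a * (a * d - b ^ 2) ≥ 0 := by nlinarith
    nlinarith [nonneg_of_mul_nonneg_right h2 h0]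

/-- Comparison of the trace and the determinant of two binary quadratic forms. -/
theorem trace_det_mono {c p q r a b d : ℝ} (hc : 0 ≤ c) (hp : 0 ≤ p) (hr : 0 ≤ r)
    (hq : q ^ 2 ≤ p * r)
    (h : ∀ x y : ℝ, c * (p * x ^ 2 + 2 * q * x * y + r * y ^ 2) ≤
      a * x ^ 2 - 2 * b * x * y + d * y ^ 2) :
    c * (p + r) ≤ a + d ∧ c ^ 2 * (p * r - q ^ 2) ≤ a * d - b ^ 2 := by
  obtain ⟨h1, h2, h3⟩ := sq_le_mul_of_form_nonneg (a := a - c * p) (b := b + c * q) (d := d - c * r)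
    (fun x y => by nlinarith [h x y])
  refine ⟨by linarith, ?_⟩
  have h4 := mixed_discriminant_nonneg (a := a - c * p) (b := b + c * q) (d := d - c * r)
    (a' := c * p) (b' := -(c * q)) (d' := c * r) h1 h2 h3 (by positivity) (by positivity)
    (by nlinarith [mul_le_mul_of_nonneg_left hq (sq_nonneg c)])
  nlinarith

/-! ### Estimates that are uniform on compact sets -/

theorem siegelForm_pos {Z : Matrix (Fin 2) (Fin 2) ℂ} (hZ : Z ∈ siegelUpperHalfSpace)
    {v : Fin 4 → ℝ} (hv : v ≠ 0) : 0 < siegelForm Z v := by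
  obtain ⟨hs, h0, hd⟩ := posDef_fin_two_iff.mp hZ.2
  rw [det_fin_two, hs] at hd
  simp only [map_apply] at h0 hd
  have hY (x y : ℝ) (h : ¬ (x = 0 ∧ y = 0)) := quadForm_pos hZ.2 (x := x) (y := y) h
  simp only [map_apply] at hY
  set p0 := v 0 * (Z 0 0).re + v 1 * (Z 0 1).re + v 2 with hp0
  set p1 := v 0 * (Z 0 1).re + v 1 * (Z 1 1).re + v 3 with hp1
  have e : siegelForm Z v = ((Z 0 0).im * p1 ^ 2 + 2 * (Z 0 1).im * p1 * (-p0) +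
      (Z 1 1).im * (-p0) ^ 2) + ((Z 0 0).im * (Z 1 1).im - (Z 0 1).im * (Z 0 1).im) *
      ((Z 0 0).im * v 0 ^ 2 + 2 * (Z 0 1).im * v 0 * v 1 + (Z 1 1).im * v 1 ^ 2) := by
    unfold siegelForm; rw [← hp0, ← hp1]; ring
  rw [e]
  have hY0 (x y : ℝ) : 0 ≤ (Z 0 0).im * x ^ 2 + 2 * (Z 0 1).im * x * y + (Z 1 1).im * y ^ 2 := by
    by_cases h : x = 0 ∧ y = 0
    · simp [h.1, h.2]
    · exact (hY x y h).le
  by_cases hc : v 0 = 0 ∧ v 1 = 0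
  · have hp : ¬ (p1 = 0 ∧ -p0 = 0) := by
      rintro ⟨h1, h2⟩
      rw [hp1, hc.1, hc.2] at h1
      rw [hp0, hc.1, hc.2] at h2
      refine hv (funext fun i => ?_)
      fin_cases i
      · exact hc.1
      · exact hc.2
      · simpa using h2
      · simpa using h1
    have := hY _ _ hp
    have := mul_nonneg hd.le (hY0 (v 0) (v 1))
    linarith
  · have := mul_pos hd (hY _ _ hc)
    linarith [hY0 p1 (-p0)]

/-- On a compact set, `siegelForm Z` is bounded below by a fixed multiple of the Euclidean form. -/
theorem exists_siegelForm_ge {K : Set (Matrix (Fin 2) (Fin 2) ℂ)} (hK : IsCompact K)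
    (hKH : K ⊆ siegelUpperHalfSpace) :
    ∃ c : ℝ, 0 < c ∧ ∀ Z ∈ K, ∀ v : Fin 4 → ℝ, c * ∑ i, v i ^ 2 ≤ siegelForm Z v := by
  have hsph : IsCompact {v : Fin 4 → ℝ | ∑ i, v i ^ 2 = 1} := by
    refine (isCompact_closedBall (0 : Fin 4 → ℝ) 1).of_isClosed_subset
      (isClosed_eq (by fun_prop) continuous_const) fun v hv => ?_
    rw [mem_closedBall_zero_iff, pi_norm_le_iff_of_nonneg zero_le_one]
    intro i
    have : v i ^ 2 ≤ 1 := by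
      rw [← show ∑ i, v i ^ 2 = 1 from hv]
      exact Finset.single_le_sum (f := fun i => v i ^ 2) (fun _ _ => sq_nonneg _)
        (Finset.mem_univ i)
    rw [Real.norm_eq_abs]
    exact abs_le_one_iff_mul_self_le_one.mpr (by nlinarith)
  have hcont : Continuous fun p : Matrix (Fin 2) (Fin 2) ℂ × (Fin 4 → ℝ) => siegelForm p.1 p.2 := by
    have hre (i j : Fin 2) : Continuous fun p : Matrix (Fin 2) (Fin 2) ℂ × (Fin 4 → ℝ) =>
        (p.1 i j).re := Complex.continuous_re.comp (continuous_fst.matrix_elem i j)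
    have him (i j : Fin 2) : Continuous fun p : Matrix (Fin 2) (Fin 2) ℂ × (Fin 4 → ℝ) =>
        (p.1 i j).im := Complex.continuous_im.comp (continuous_fst.matrix_elem i j)
    unfold siegelForm
    fun_prop
  obtain ⟨c, hc, h⟩ := (hK.prod hsph).exists_forall_le' hcont.continuousOn (a := 0) (by
    rintro ⟨Z, v⟩ ⟨hZ, hv⟩
    refine siegelForm_pos (hKH hZ) ?_
    rintro rfl
    simp at hv)
  refine ⟨c, hc, fun Z hZ v => ?_⟩
  by_cases hv : v = 0
  · simp [hv, siegelForm]
  · have hpos : 0 < ∑ i, v i ^ 2 := by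
      obtain ⟨i, hi⟩ := Function.ne_iff.mp hv
      exact Finset.sum_pos' (fun _ _ => sq_nonneg _) ⟨i, Finset.mem_univ _, sq_pos_of_ne_zero hi⟩
    set s := ∑ i, v i ^ 2 with hs
    have hsq : √s ^ 2 = s := Real.sq_sqrt hpos.le
    have h1 := h (Z, fun i => v i / √s) ⟨hZ, by
      simp only [Set.mem_ofPred_eq, div_pow, hsq, ← Finset.sum_div]
      rw [← hs, div_self hpos.ne']⟩
    have h2 : siegelForm Z (fun i => v i / √s) = siegelForm Z v / s := by
      have : √s ≠ 0 := (Real.sqrt_pos.mpr hpos).ne'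
      rw [eq_div_iff hpos.ne']
      conv_lhs => rw [← hsq]
      rw [Real.sqrt_sq (Real.sqrt_nonneg s)]
      unfold siegelForm
      field_simp
    simp only [h2] at h1
    rwa [le_div_iff₀ hpos] at h1

/-- The Gram determinant of the bottom rows is a positive integer. -/
theorem one_le_gram_bottomRow (M : Gam) :
    (1 : ℝ) ≤ (∑ i, (bottomRow M 0 i : ℝ) ^ 2) * (∑ i, (bottomRow M 1 i : ℝ) ^ 2) -
      (∑ i, (bottomRow M 0 i : ℝ) * bottomRow M 1 i) ^ 2 := by
  set a := bottomRow M 0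
  set r := bottomRow M 1
  have key : 0 < (∑ i, a i ^ 2) * (∑ i, r i ^ 2) - (∑ i, a i * r i) ^ 2 := by
    by_contra hneg
    have lag : (∑ i, a i ^ 2) * (∑ i, r i ^ 2) - (∑ i, a i * r i) ^ 2 =
        (a 0 * r 1 - a 1 * r 0) ^ 2 + (a 0 * r 2 - a 2 * r 0) ^ 2 +
        (a 0 * r 3 - a 3 * r 0) ^ 2 + (a 1 * r 2 - a 2 * r 1) ^ 2 +
        (a 1 * r 3 - a 3 * r 1) ^ 2 + (a 2 * r 3 - a 3 * r 2) ^ 2 := by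
      simp only [Fin.sum_univ_four]; ring
    rw [lag] at hneg
    have minor (s t : Fin 4) (hst : s < t) : a s * r t - a t * r s = 0 := by
      have n1 := sq_nonneg (a 0 * r 1 - a 1 * r 0)
      have n2 := sq_nonneg (a 0 * r 2 - a 2 * r 0)
      have n3 := sq_nonneg (a 0 * r 3 - a 3 * r 0)
      have n4 := sq_nonneg (a 1 * r 2 - a 2 * r 1)
      have n5 := sq_nonneg (a 1 * r 3 - a 3 * r 1)
      have n6 := sq_nonneg (a 2 * r 3 - a 3 * r 2)
      apply pow_eq_zero_iff two_ne_zero |>.mp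
      fin_cases s <;> fin_cases t <;> first | (exact absurd hst (by decide)) | skip
      all_goals simp only [Fin.zero_eta, Fin.mk_one, Fin.reduceFinMk]; linarith
    have minor' (s t : Fin 4) : a s * r t = a t * r s := by
      rcases lt_trichotomy s t with h | h | h
      · linarith [minor s t h]
      · rw [h]
      · linarith [minor t s h]
    obtain ⟨i, hi⟩ := Function.ne_iff.mp (bottomRow_mem_isotropicPairs M).1
    have hi' : a i ≠ 0 := hi
    -- the rows satisfy `a_i • r - r_i • a = 0`, which contradicts `det M ≠ 0`
    have hdet : M.1.det ≠ 0 := (SymplecticGroup.symplectic_det M.2).ne_zero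
    refine hdet (exists_vecMul_eq_zero_iff.mp ⟨Sum.elim 0 ![-r i, a i], ?_, ?_⟩)
    · intro h0
      exact hi' (by simpa using congrFun h0 (Sum.inr 1))
    · ext j
      have hrow (t : Fin 4) : -r i * a t + a i * r t = 0 := by
        have := minor' i t
        linarith
      simp only [vecMul, dotProduct, Fintype.sum_sum_type, Fin.sum_univ_two, Sum.elim_inl,
        Sum.elim_inr, Pi.zero_apply, zero_mul, zero_add, cons_val_zero, cons_val_one]
      rcases j with j | j <;> fin_cases j
      · exact hrow 0
      · exact hrow 1
      · exact hrow 2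
      · exact hrow 3
  have key1 : 1 ≤ (∑ i, a i ^ 2) * (∑ i, r i ^ 2) - (∑ i, a i * r i) ^ 2 := key
  exact_mod_cast key1

/-- Suppose that `siegelForm Z` is at least `c` times the Euclidean form. Let `δ = |det (C Z + D)|²`
and `Q` the Gram matrix of the bottom rows. Then `M • Z` has positive definite imaginary part,
`c tr Q ≤ δ tr Im (M • Z)` and `c² det Q ≤ δ det (Im Z)`. -/
theorem im_act_estimates {c : ℝ} (hc : 0 < c) (M : Gam) {Z : Matrix (Fin 2) (Fin 2) ℂ}
    (hZ : Z ∈ siegelUpperHalfSpace)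
    (h : ∀ v : Fin 4 → ℝ, c * ∑ i, v i ^ 2 ≤ siegelForm Z v) :
    ((act M Z).map Complex.im).PosDef ∧
    c * ((∑ i, (bottomRow M 0 i : ℝ) ^ 2) + ∑ i, (bottomRow M 1 i : ℝ) ^ 2) ≤
      ‖(autoFactor M Z).det‖ ^ 2 * ((act M Z).map Complex.im).trace ∧
    c ^ 2 * ((∑ i, (bottomRow M 0 i : ℝ) ^ 2) * (∑ i, (bottomRow M 1 i : ℝ) ^ 2) -
      (∑ i, (bottomRow M 0 i : ℝ) * bottomRow M 1 i) ^ 2) ≤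
      ‖(autoFactor M Z).det‖ ^ 2 * (Z.map Complex.im).det := by
  have hδ : 0 < ‖(autoFactor M Z).det‖ ^ 2 :=
    pow_pos (norm_pos_iff.mpr (autoFactor_det_ne_zero M hZ)) 2
  have hdet := det_im_act M hZ
  have hW : act M Z 1 0 = act M Z 0 1 := (act_isSymm M hZ).apply 0 1
  have hform := siegelForm_bottomRow M hZ
  set δ := ‖(autoFactor M Z).det‖ ^ 2
  set p := ∑ i, (bottomRow M 0 i : ℝ) ^ 2
  set q := ∑ i, (bottomRow M 0 i : ℝ) * bottomRow M 1 i
  set r := ∑ i, (bottomRow M 1 i : ℝ) ^ 2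
  have hgram : 1 ≤ p * r - q ^ 2 := one_le_gram_bottomRow M
  have hp : 0 ≤ p := Finset.sum_nonneg fun _ _ => sq_nonneg _
  have hr : 0 ≤ r := Finset.sum_nonneg fun _ _ => sq_nonneg _
  have hcmp (x y : ℝ) : c * (p * x ^ 2 + 2 * q * x * y + r * y ^ 2) ≤
      (δ * (act M Z 1 1).im) * x ^ 2 - 2 * (δ * (act M Z 0 1).im) * x * y +
        (δ * (act M Z 0 0).im) * y ^ 2 := by
    have h1 := h (fun i => x * bottomRow M 0 i + y * bottomRow M 1 i)
    rw [hform x y] at h1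
    have e : ∑ i, (x * (bottomRow M 0 i : ℝ) + y * bottomRow M 1 i) ^ 2 =
        p * x ^ 2 + 2 * q * x * y + r * y ^ 2 := by
      simp only [p, q, r, Fin.sum_univ_four]; ring
    rw [e] at h1
    linarith
  have hr0 : 0 < r := by
    rcases hr.eq_or_lt with h0 | h0
    · rw [← h0] at hgram; nlinarith [sq_nonneg q]
    · exact h0
  obtain ⟨htr, hde⟩ := trace_det_mono hc.le hp hr (by linarith) hcmp
  have hdY : 0 < (Z.map Complex.im).det := hZ.2.det_pos
  rw [← hdet]
  refine ⟨posDef_fin_two_iff.mpr ⟨?_, ?_, ?_⟩, ?_, ?_⟩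
  · simp [hW]
  · have := hcmp 0 1
    have h2 : 0 < δ * (act M Z 0 0).im := by nlinarith [mul_pos hc hr0]
    simpa using pos_of_mul_pos_right h2 hδ.le
  · exact pos_of_mul_pos_right (by rw [hdet]; exact hdY) hδ.le
  · simp only [trace_fin_two, map_apply]
    linarith
  · simp only [det_fin_two, map_apply, hW]
    nlinarith

/-- For a positive definite `S` there is `c > 0` with `c tr Y ≤ tr (S Y)` for all positive
definite `Y`; in fact `c = det S / tr S` works. -/
theorem exists_trace_mul_ge {S : Matrix (Fin 2) (Fin 2) ℝ} (hS : S.PosDef) :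
    ∃ c : ℝ, 0 < c ∧ ∀ Y : Matrix (Fin 2) (Fin 2) ℝ, Y.PosDef → c * Y.trace ≤ (S * Y).trace := by
  have hd := hS.det_pos
  have h0 : 0 < S 0 0 := hS.diag_pos
  have h1 : 0 < S 1 1 := hS.diag_pos
  have hs := (posDef_fin_two_iff.mp hS).1
  rw [det_fin_two, hs] at hd
  set c := (S 0 0 * S 1 1 - S 0 1 * S 0 1) / (S 0 0 + S 1 1) with hc
  have hmul : c * (S 0 0 + S 1 1) = S 0 0 * S 1 1 - S 0 1 * S 0 1 := by
    rw [hc]; field_simp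
  have hc0 : 0 < c := by positivity
  refine ⟨c, hc0, fun Y hY => ?_⟩
  have hd' := hY.det_pos
  have h0' : 0 < Y 0 0 := hY.diag_pos
  have h1' : 0 < Y 1 1 := hY.diag_pos
  have hs' := (posDef_fin_two_iff.mp hY).1
  rw [det_fin_two, hs'] at hd'
  have ha : 0 ≤ S 0 0 - c := by
    refine nonneg_of_mul_nonneg_left (b := S 0 0 + S 1 1) ?_ (by positivity)
    nlinarith [sq_nonneg (S 0 1), sq_nonneg (S 0 0)]
  have hb : 0 ≤ S 1 1 - c := by
    refine nonneg_of_mul_nonneg_left (b := S 0 0 + S 1 1) ?_ (by positivity)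
    nlinarith [sq_nonneg (S 0 1), sq_nonneg (S 1 1)]
  have := mixed_discriminant_nonneg (a := S 0 0 - c) (b := S 0 1) (d := S 1 1 - c)
    (a' := Y 1 1) (b' := -Y 0 1) (d' := Y 0 0) ha hb (by nlinarith [sq_nonneg c]) h1'.le h0'.le
    (by nlinarith)
  simp only [trace_fin_two, Matrix.mul_apply, Fin.sum_univ_two, hs, hs']
  linarith

/-! ### Simultaneous diagonalization -/

/-- Simultaneous diagonalization of two positive definite matrices. -/
theorem exists_simultaneous_diagonalization {T Y : Matrix (Fin 2) (Fin 2) ℝ} (hT : T.PosDef)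
    (hY : Y.PosDef) : ∃ (P : Matrix (Fin 2) (Fin 2) ℝ) (s : Fin 2 → ℝ), P.det ≠ 0 ∧
      T = P * Pᵀ ∧ Pᵀ * Y * P = diagonal s ∧ ∀ i, 0 < s i := by
  obtain ⟨R, hR, hTR⟩ : ∃ R : Matrix (Fin 2) (Fin 2) ℝ, R.det ≠ 0 ∧ T = R * Rᵀ := by
    set U : Matrix (Fin 2) (Fin 2) ℝ := (hT.isHermitian.eigenvectorUnitary).1 with hU
    set d := hT.isHermitian.eigenvalues with hd
    have hspec := hT.isHermitian.spectral_theorem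
    rw [Unitary.conjStarAlgAut_apply] at hspec
    have hTR : T = (U * diagonal fun i => √(d i)) * (U * diagonal fun i => √(d i))ᵀ := by
      rw [transpose_mul, diagonal_transpose, ← Matrix.mul_assoc, Matrix.mul_assoc U,
        diagonal_mul_diagonal]
      simp only [Real.mul_self_sqrt (hT.posSemidef.eigenvalues_nonneg _), hd]
      exact hspec
    refine ⟨_, ?_, hTR⟩
    intro h0
    have := hT.det_pos
    rw [hTR, det_mul, h0, zero_mul] at this
    exact lt_irrefl _ this
  have hS : (Rᵀ * Y * R).PosDef := by
    have hu : IsUnit R := (isUnit_iff_isUnit_det R).mpr (Ne.isUnit hR)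
    have := (IsUnit.posDef_star_left_conjugate_iff (x := Y) hu).mpr hY
    simpa [star_eq_conjTranspose, conjTranspose_eq_transpose_of_trivial] using this
  set U : Matrix (Fin 2) (Fin 2) ℝ := (hS.isHermitian.eigenvectorUnitary).1 with hU
  have hUU : Uᵀ * U = 1 := Unitary.coe_star_mul_self hS.isHermitian.eigenvectorUnitary
  have hUU' : U * Uᵀ = 1 := Unitary.coe_mul_star_self hS.isHermitian.eigenvectorUnitary
  have hdiag := hS.isHermitian.conjStarAlgAut_star_eigenvectorUnitary
  rw [Unitary.conjStarAlgAut_star_apply] at hdiag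
  refine ⟨R * U, hS.isHermitian.eigenvalues, ?_, ?_, ?_, hS.eigenvalues_pos⟩
  · rw [det_mul]
    refine mul_ne_zero hR fun h0 => ?_
    have := congrArg Matrix.det hUU
    rw [det_mul, h0, mul_zero, det_one] at this
    exact zero_ne_one this
  · rw [transpose_mul, Matrix.mul_assoc, ← Matrix.mul_assoc U, hUU', Matrix.one_mul, hTR]
  · rw [transpose_mul]
    calc Uᵀ * Rᵀ * Y * (R * U) = Uᵀ * (Rᵀ * Y * R) * U := by noncomm_ring
      _ = _ := hdiag

/-- In the situation of a simultaneous diagonalization, `T Y` is conjugate to `diagonal s`. -/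
theorem mul_eq_conj_diagonal {T Y P : Matrix (Fin 2) (Fin 2) ℝ} {s : Fin 2 → ℝ} (hP : P.det ≠ 0)
    (hT : T = P * Pᵀ) (hY : Pᵀ * Y * P = diagonal s) : T * Y = P * diagonal s * P⁻¹ := by
  rw [← hY, hT]
  simp only [Matrix.mul_assoc]
  rw [mul_nonsing_inv _ (Ne.isUnit hP), Matrix.mul_one]

theorem spectrum_mul_eq_range {T Y P : Matrix (Fin 2) (Fin 2) ℝ} {s : Fin 2 → ℝ} (hP : P.det ≠ 0)
    (hT : T = P * Pᵀ) (hY : Pᵀ * Y * P = diagonal s) : spectrum ℝ (T * Y) = Set.range s := by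
  rw [mul_eq_conj_diagonal hP hT hY, ← spectrum_diagonal s]
  exact spectrum.units_conjugate (u := nonsingInvUnit P (Ne.isUnit hP))

theorem det_trace_mul_eq {T Y P : Matrix (Fin 2) (Fin 2) ℝ} {s : Fin 2 → ℝ} (hP : P.det ≠ 0)
    (hT : T = P * Pᵀ) (hY : Pᵀ * Y * P = diagonal s) :
    (T * Y).det = s 0 * s 1 ∧ (T * Y).trace = s 0 + s 1 := by
  rw [mul_eq_conj_diagonal hP hT hY]
  constructor
  · rw [det_mul_right_comm, det_mul, det_mul, ← det_mul P, mul_nonsing_inv _ (Ne.isUnit hP),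
      det_one, one_mul, det_diagonal, Fin.prod_univ_two]
  · rw [trace_mul_cycle, nonsing_inv_mul _ (Ne.isUnit hP), Matrix.one_mul, trace_diagonal,
      Fin.sum_univ_two]

/-! ### The terms of the Poincaré series -/

theorem continuous_symMat : Continuous symMat := by
  refine continuous_matrix fun i j => ?_
  fin_cases i <;> fin_cases j <;> simp [symMat] <;> fun_prop

theorem measurableSet_posDef_symMat_add (S : Matrix (Fin 2) (Fin 2) ℝ) :
    MeasurableSet {u : Fin 3 → ℝ | (symMat u + S).PosDef} := by
  have hc : Continuous fun u => symMat u + S := continuous_symMat.add continuous_const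
  have he (i j : Fin 2) : Continuous fun u => (symMat u + S) i j := hc.matrix_elem i j
  simp only [posDef_fin_two_iff]
  exact (isClosed_eq (he 1 0) (he 0 1)).measurableSet.inter
    ((isOpen_lt continuous_const (he 0 0)).measurableSet.inter
      (isOpen_lt continuous_const hc.matrix_det).measurableSet)

theorem confluentH_nonneg (α β : ℝ) (T Y : Matrix (Fin 2) (Fin 2) ℝ) :
    0 ≤ confluentH α β T Y := by
  refine setIntegral_nonneg ?_ fun u hu => ?_
  · have h := measurableSet_posDef_symMat_add (-T)
    simp only [← sub_eq_add_neg] at h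
    exact (measurableSet_posDef_symMat_add T).inter h
  · have := hu.1.det_pos
    have := hu.2.det_pos
    positivity

theorem rpow_mul_exp_neg_le {b x : ℝ} (hb : 0 < b) (hx : 0 ≤ x) :
    x ^ b * Real.exp (-2 * π * x) ≤ 1 + (⌈b⌉₊.factorial : ℝ) := by
  set n := ⌈b⌉₊
  have h1 : x ^ b ≤ 1 + x ^ n := by
    rcases le_total x 1 with h | h
    · exact (Real.rpow_le_one hx h hb.le).trans (by linarith [pow_nonneg hx n])
    · have := Real.rpow_le_rpow_of_exponent_le h (Nat.le_ceil b)
      rw [Real.rpow_natCast] at this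
      linarith
  have h2 : x ^ n ≤ n.factorial * Real.exp x := by
    have := Real.pow_div_factorial_le_exp x hx n
    rwa [div_le_iff₀' (by positivity)] at this
  have h3 : Real.exp x * Real.exp (-2 * π * x) ≤ 1 := by
    rw [← Real.exp_add, Real.exp_le_one_iff]
    nlinarith [Real.pi_gt_three]
  have h4 : Real.exp (-2 * π * x) ≤ 1 := by
    rw [Real.exp_le_one_iff]
    nlinarith [Real.pi_gt_three]
  calc x ^ b * Real.exp (-2 * π * x)
      ≤ (1 + n.factorial * Real.exp x) * Real.exp (-2 * π * x) := by gcongr; linarith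
    _ = Real.exp (-2 * π * x) + n.factorial * (Real.exp x * Real.exp (-2 * π * x)) := by ring
    _ ≤ 1 + n.factorial * 1 := by gcongr
    _ = _ := by ring

/-- The powers of the determinants in the definition of an admissible exponent cancel. -/
theorem shimura_factor_eq {k t y : ℝ} (ht : 0 < t) (hy : 0 < y) :
    t * y * ((2 * π) ^ 2 * (t * y)) ^ (k - 1 / 2) * ((2 * π) ^ 2 * y) ^ (-k - 1 / 2) =
      t * t ^ (k - 1 / 2) / (2 * π) ^ 2 := by
  have h2 : 0 < (2 * π) ^ 2 := by positivity
  have h1 : (2 * π) ^ 2 * (t * y) = t * ((2 * π) ^ 2 * y) := by ring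
  have h3 : -k - 1 / 2 = -1 - (k - 1 / 2) := by ring
  have h4 : 0 < (2 * π) ^ 2 * y := by positivity
  rw [h1, h3]
  generalize k - 1 / 2 = m
  have h5 : 0 < ((2 * π) ^ 2 * y) ^ m := Real.rpow_pos_of_pos h4 _
  rw [Real.mul_rpow ht.le h4.le, Real.rpow_sub h4, Real.rpow_neg_one]
  field_simp

/-- The bound that an admissible exponent `b` yields in terms of `det Y` only: the smallest
eigenvalue is at least `det (T Y) / tr (T Y)`, and the exponential absorbs the power of the
trace. -/
theorem IsShimuraExponent.exists_le_det {k : ℕ} {b : ℝ} (h : IsShimuraExponent k b)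
    {T : Matrix (Fin 2) (Fin 2) ℝ} (hT : T.PosDef) :
    ∃ C : ℝ, 0 < C ∧ ∀ Y : Matrix (Fin 2) (Fin 2) ℝ, Y.PosDef →
      (T * Y).det * confluentH (k + 1) 1 T Y ≤ C * (1 + Y.det ^ (-b)) := by
  obtain ⟨hb, a, ha, h⟩ := h
  have ht := hT.det_pos
  set t := T.det with htdef
  set D : ℝ := (1 + (⌈b⌉₊.factorial : ℝ)) * t ^ (-b) with hD
  have hD0 : 0 < D := by positivity
  set E : ℝ := 2 ^ (2 * k + 2) * π * (t * t ^ ((k : ℝ) - 1 / 2) / (2 * π) ^ 2) * a with hE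
  have hE0 : 0 < E := by positivity
  refine ⟨E * (1 + D), by positivity, fun Y hY => ?_⟩
  have hy := hY.det_pos
  obtain ⟨P, s, hP, hTP, hYP, hs⟩ := exists_simultaneous_diagonalization hT hY
  obtain ⟨hdet, htr⟩ := det_trace_mul_eq hP hTP hYP
  have hspec := spectrum_mul_eq_range hP hTP hYP
  set lam := min (s 0) (s 1) with hlam
  have hleast : IsLeast (spectrum ℝ (T * Y)) lam := by
    rw [hspec]
    constructor
    · rcases min_choice (s 0) (s 1) with h | h
      · exact ⟨0, by rw [hlam, h]⟩
      · exact ⟨1, by rw [hlam, h]⟩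
    · rintro _ ⟨i, rfl⟩
      fin_cases i
      · exact min_le_left _ _
      · exact min_le_right _ _
  have h1 := h T Y hT hY lam hleast
  set τ := (T * Y).trace with hτ
  have hτ0 : 0 < τ := by rw [htr]; exact add_pos (hs 0) (hs 1)
  have hlam_ge : t * Y.det / τ ≤ lam := by
    rw [htdef, ← det_mul, hdet, htr, div_le_iff₀ (add_pos (hs 0) (hs 1))]
    have h0 := hs 0
    have h1 := hs 1
    rcases min_choice (s 0) (s 1) with h | h <;> rw [hlam, h] <;> nlinarith
  have hlamb : lam ^ (-b) ≤ τ ^ b * (t ^ (-b) * Y.det ^ (-b)) := by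
    calc lam ^ (-b) ≤ (t * Y.det / τ) ^ (-b) :=
          Real.rpow_le_rpow_of_nonpos (by positivity) hlam_ge (by linarith)
      _ = _ := by
        rw [Real.div_rpow (by positivity) hτ0.le, Real.mul_rpow ht.le hy.le, Real.rpow_neg hτ0.le,
          div_inv_eq_mul, mul_comm]
  have hexp : Real.exp (-2 * π * τ) ≤ 1 := by
    rw [Real.exp_le_one_iff]
    nlinarith [Real.pi_gt_three]
  have hmain : Real.exp (-2 * π * τ) * (1 + lam ^ (-b)) ≤ (1 + D) * (1 + Y.det ^ (-b)) := by
    have hyb : 0 < Y.det ^ (-b) := Real.rpow_pos_of_pos hy _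
    have hx := rpow_mul_exp_neg_le hb hτ0.le
    calc Real.exp (-2 * π * τ) * (1 + lam ^ (-b))
        ≤ Real.exp (-2 * π * τ) * (1 + τ ^ b * (t ^ (-b) * Y.det ^ (-b))) := by gcongr
      _ = Real.exp (-2 * π * τ) +
          (τ ^ b * Real.exp (-2 * π * τ)) * (t ^ (-b) * Y.det ^ (-b)) := by ring
      _ ≤ 1 + (1 + (⌈b⌉₊.factorial : ℝ)) * (t ^ (-b) * Y.det ^ (-b)) := by gcongr
      _ = 1 + D * Y.det ^ (-b) := by rw [hD]; ring
      _ ≤ _ := by nlinarith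
  refine h1.trans ?_
  have hf := shimura_factor_eq (k := (k : ℝ)) ht hy
  have e1 : ((2 * π) • (T * Y)).det = (2 * π) ^ 2 * (t * Y.det) := by
    rw [det_smul, det_mul]; simp [htdef]
  have e2 : ((2 * π) • Y).det = (2 * π) ^ 2 * Y.det := by
    rw [det_smul]; simp
  rw [e1, e2, det_mul, ← htdef]
  calc _ = 2 ^ (2 * k + 2) * π * (t * Y.det * ((2 * π) ^ 2 * (t * Y.det)) ^ ((k : ℝ) - 1 / 2) *
        ((2 * π) ^ 2 * Y.det) ^ (-(k : ℝ) - 1 / 2)) * a *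
          (Real.exp (-2 * π * τ) * (1 + lam ^ (-b))) := by ring
    _ = E * (Real.exp (-2 * π * τ) * (1 + lam ^ (-b))) := by rw [hf]
    _ ≤ E * ((1 + D) * (1 + Y.det ^ (-b))) := by gcongr
    _ = _ := by ring

/-- An elementary inequality, applied with `δ = |det (C Z + D)|²` and the trace `ρ` and determinant
`G` of the Gram matrix of the bottom rows. The hypothesis `6 ≤ w - 2 b` leaves `δ⁻³`, which the
exponential converts into `(ρ + G)⁻³`. -/
theorem exists_automorphy_bound {δ₀ d κ A b w : ℝ} (hδ₀ : 0 < δ₀) (hd : 0 < d) (hκ : 0 < κ)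
    (hA : 0 < A) (hw : 6 ≤ w - 2 * b) (hb : 0 < b) :
    ∃ C : ℝ, 0 < C ∧ ∀ δ ρ G : ℝ, δ₀ ≤ δ → 0 ≤ ρ → 0 ≤ G → G ≤ A * δ → 0 < ρ + G →
      δ ^ (-w / 2) * (1 + (d / δ) ^ (-b)) * Real.exp (-(κ * (ρ / δ))) ≤ C * ((ρ + G) ^ 3)⁻¹ := by
  set e := w / 2 - b - 3 with he
  have he0 : 0 ≤ e := by rw [he]; linarith
  refine ⟨(δ₀ ^ (-e) * (δ₀ ^ (-b) + d ^ (-b))) * (6 * (κ ^ 3)⁻¹ * Real.exp (κ * A)), by positivity,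
    fun δ ρ G hδ hρ hG hGA hpos => ?_⟩
  have hδp : 0 < δ := hδ₀.trans_le hδ
  have h1 : δ ^ (-w / 2) * (1 + (d / δ) ^ (-b)) ≤
      (δ₀ ^ (-e) * (δ₀ ^ (-b) + d ^ (-b))) * (δ ^ 3)⁻¹ := by
    have e1 : δ ^ (-w / 2) = (δ ^ 3)⁻¹ * δ ^ (-b) * δ ^ (-e) := by
      have : -w / 2 = -(3 : ℕ) + -b + -e := by rw [he]; push_cast; ring
      rw [this, Real.rpow_add hδp, Real.rpow_add hδp, Real.rpow_neg hδp.le, Real.rpow_natCast]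
    have e2 : δ ^ (-b) * (d / δ) ^ (-b) = d ^ (-b) := by
      rw [← Real.mul_rpow hδp.le (by positivity)]
      congr 1; field_simp
    have e3 : δ ^ (-e) ≤ δ₀ ^ (-e) := Real.rpow_le_rpow_of_nonpos hδ₀ hδ (by linarith)
    have e4 : δ ^ (-b) ≤ δ₀ ^ (-b) := Real.rpow_le_rpow_of_nonpos hδ₀ hδ (by linarith)
    calc δ ^ (-w / 2) * (1 + (d / δ) ^ (-b))
        = δ ^ (-e) * (δ ^ (-b) + δ ^ (-b) * (d / δ) ^ (-b)) * (δ ^ 3)⁻¹ := by rw [e1]; ring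
      _ = δ ^ (-e) * (δ ^ (-b) + d ^ (-b)) * (δ ^ 3)⁻¹ := by rw [e2]
      _ ≤ _ := by gcongr
  have h2 : (δ ^ 3)⁻¹ * Real.exp (-(κ * (ρ / δ))) ≤
      (6 * (κ ^ 3)⁻¹ * Real.exp (κ * A)) * ((ρ + G) ^ 3)⁻¹ := by
    have hρδ : 0 ≤ ρ / δ := by positivity
    have e1 : ((ρ + G) / δ) ^ 3 ≤ (ρ / δ + A) ^ 3 := by
      have : G / δ ≤ A := by rwa [div_le_iff₀ hδp]
      rw [add_div]; gcongr
    have e2 : (κ * (ρ / δ + A)) ^ 3 ≤ 6 * Real.exp (κ * (ρ / δ + A)) := by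
      have := Real.pow_div_factorial_le_exp (κ * (ρ / δ + A)) (by positivity) 3
      rw [div_le_iff₀' (by positivity)] at this
      simpa [Nat.factorial] using this
    have e3 : ((ρ + G) / δ) ^ 3 * Real.exp (-(κ * (ρ / δ))) ≤
        6 * (κ ^ 3)⁻¹ * Real.exp (κ * A) := by
      calc ((ρ + G) / δ) ^ 3 * Real.exp (-(κ * (ρ / δ)))
          ≤ (ρ / δ + A) ^ 3 * Real.exp (-(κ * (ρ / δ))) := by gcongr
        _ = (κ ^ 3)⁻¹ * (κ * (ρ / δ + A)) ^ 3 * Real.exp (-(κ * (ρ / δ))) := by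
          field_simp
        _ ≤ (κ ^ 3)⁻¹ * (6 * Real.exp (κ * (ρ / δ + A))) * Real.exp (-(κ * (ρ / δ))) := by gcongr
        _ = 6 * (κ ^ 3)⁻¹ * (Real.exp (κ * (ρ / δ + A)) * Real.exp (-(κ * (ρ / δ)))) := by ring
        _ = _ := by rw [← Real.exp_add]; ring_nf
    rw [← div_eq_mul_inv _ ((ρ + G) ^ 3), le_div_iff₀ (by positivity)]
    calc _ = ((ρ + G) / δ) ^ 3 * Real.exp (-(κ * (ρ / δ))) := by rw [div_pow]; ring
      _ ≤ _ := e3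
  calc _ ≤ (δ₀ ^ (-e) * (δ₀ ^ (-b) + d ^ (-b))) * (δ ^ 3)⁻¹ * Real.exp (-(κ * (ρ / δ))) := by
        gcongr
    _ = (δ₀ ^ (-e) * (δ₀ ^ (-b) + d ^ (-b))) * ((δ ^ 3)⁻¹ * Real.exp (-(κ * (ρ / δ)))) := by ring
    _ ≤ _ := (mul_le_mul_of_nonneg_left h2 (by positivity)).trans_eq (by ring)

theorem norm_Psi (k : ℕ) (T : Matrix (Fin 2) (Fin 2) ℝ) (Z : Matrix (Fin 2) (Fin 2) ℂ) :
    ‖Psi k T Z‖ = |(T * Z.map Complex.im).det * confluentH (k + 1) 1 T (Z.map Complex.im)| := by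
  unfold Psi
  rw [norm_mul, Complex.norm_real, Real.norm_eq_abs, Complex.norm_exp]
  simp

theorem norm_Phi (T : Matrix (Fin 2) (Fin 2) ℝ) (Z : Matrix (Fin 2) (Fin 2) ℂ) :
    ‖Phi T Z‖ = Real.exp (-2 * π * (T * Z.map Complex.im).trace) := by
  unfold Phi
  rw [Complex.norm_exp]
  congr 1
  simp [trace_fin_two, Matrix.mul_apply, Fin.sum_univ_two]

/-- On a compact set the terms of the series are dominated, uniformly, by the inverse cube of the
size of the bottom rows. -/
theorem exists_norm_cosetRepTerm_le {k l : ℕ} {b : ℝ} (hb : IsShimuraExponent k b)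
    (hl : (6 : ℝ) ≤ (l : ℝ) + (k : ℝ) - 2 * b) {T T' : Matrix (Fin 2) (Fin 2) ℝ} (hT : T.PosDef)
    (hT' : T'.PosDef) {K : Set (Matrix (Fin 2) (Fin 2) ℂ)} (hK : IsCompact K)
    (hKH : K ⊆ siegelUpperHalfSpace) :
    ∃ C : ℝ, 0 < C ∧ ∀ Z ∈ K, ∀ M : Gam, ‖cosetRepTerm k l T T' M Z‖ ≤
      C * (gramSize (bottomRow M 0) (bottomRow M 1) ^ 3)⁻¹ := by
  obtain ⟨c, hc, hform⟩ := exists_siegelForm_ge hK hKH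
  obtain ⟨c', hc', htrace⟩ := exists_trace_mul_ge hT'
  obtain ⟨C₁, hC₁, hPsi⟩ := hb.exists_le_det hT
  have hcont : Continuous fun Z : Matrix (Fin 2) (Fin 2) ℂ => (Z.map Complex.im).det :=
    (continuous_id.matrix_map Complex.continuous_im).matrix_det
  obtain ⟨d₁, hd₁, hlow⟩ := hK.exists_forall_le' hcont.continuousOn (a := 0)
    fun Z hZ => (hKH hZ).2.det_pos
  obtain ⟨d₂, hupp⟩ := hK.exists_bound_of_continuousOn hcont.continuousOn
  set d₃ := max d₂ 1 with hd₃
  have hd₃0 : 0 < d₃ := lt_max_of_lt_right one_pos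
  obtain ⟨C₂, hC₂, hbound⟩ := exists_automorphy_bound (δ₀ := c ^ 2 / d₃) (d := d₁)
    (κ := 2 * π * (c' * c)) (A := d₃ / c ^ 2) (b := b) (w := (l : ℝ) + k) (by positivity) hd₁
    (by positivity) (by positivity) hl hb.1
  refine ⟨C₁ * C₂, by positivity, fun Z hZK M => ?_⟩
  have hZ := hKH hZK
  obtain ⟨hpd, htr, hgr⟩ := im_act_estimates hc M hZ (hform Z hZK)
  have hdet := det_im_act M hZ
  have hgram := one_le_gram_bottomRow M
  have hJ : 0 < ‖(autoFactor M Z).det‖ := norm_pos_iff.mpr (autoFactor_det_ne_zero M hZ)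
  have hYd := hlow Z hZK
  have hYu : (Z.map Complex.im).det ≤ d₃ :=
    ((le_abs_self _).trans (hupp Z hZK)).trans (le_max_left _ _)
  set n := ‖(autoFactor M Z).det‖ with hn
  set δ := n ^ 2 with hδ
  have hδ0 : 0 < δ := by positivity
  set ρ := (∑ i, (bottomRow M 0 i : ℝ) ^ 2) + ∑ i, (bottomRow M 1 i : ℝ) ^ 2 with hρ
  set G := (∑ i, (bottomRow M 0 i : ℝ) ^ 2) * (∑ i, (bottomRow M 1 i : ℝ) ^ 2) -
      (∑ i, (bottomRow M 0 i : ℝ) * bottomRow M 1 i) ^ 2 with hG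
  set W := (act M Z).map Complex.im with hW
  have hρ0 : 0 ≤ ρ := by positivity
  have hGδ : c ^ 2 * G ≤ d₃ * δ :=
    hgr.trans ((mul_le_mul_of_nonneg_left hYu hδ0.le).trans_eq (mul_comm _ _))
  have hmain := hbound δ ρ G (by rw [div_le_iff₀' hd₃0]; nlinarith [sq_nonneg c]) hρ0 (by linarith)
    (by rw [div_mul_eq_mul_div, le_div_iff₀' (by positivity)]; exact hGδ) (by linarith)
  have hWdet : d₁ / δ ≤ W.det := by
    rw [div_le_iff₀' hδ0, hdet]; exact hYd
  have hPsi_le : ‖Psi k T (act M Z)‖ ≤ C₁ * (1 + (d₁ / δ) ^ (-b)) := by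
    rw [norm_Psi, abs_of_nonneg (mul_nonneg (by
      rw [det_mul]; exact (mul_pos hT.det_pos hpd.det_pos).le) (confluentH_nonneg _ _ _ _))]
    refine (hPsi W hpd).trans ?_
    have := Real.rpow_le_rpow_of_nonpos (by positivity) hWdet (neg_nonpos.mpr hb.1.le)
    gcongr
  have hPhi_le : ‖Phi T' (act M Z)‖ ≤ Real.exp (-(2 * π * (c' * c) * (ρ / δ))) := by
    rw [norm_Phi, Real.exp_le_exp]
    have h1 := htrace W hpd
    have h2 : c * (ρ / δ) ≤ W.trace := by
      rw [← mul_div_assoc, div_le_iff₀' hδ0]; exact htr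
    have h3 : c' * (c * (ρ / δ)) ≤ (T' * W).trace :=
      (mul_le_mul_of_nonneg_left h2 hc'.le).trans h1
    nlinarith [Real.pi_pos]
  have hfac : ‖(autoFactor M Z).det ^ (-((k + l : ℕ) : ℤ))‖ = δ ^ (-((l : ℝ) + k) / 2) := by
    rw [norm_zpow, ← hn, hδ, ← Real.rpow_natCast, ← Real.rpow_mul hJ.le, ← Real.rpow_intCast]
    congr 1
    push_cast; ring
  have hsize : gramSize (bottomRow M 0) (bottomRow M 1) = ρ + G := rfl
  have hterm : ‖cosetRepTerm k l T T' M Z‖ = δ ^ (-((l : ℝ) + k) / 2) *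
      (‖Psi k T (act M Z)‖ * ‖Phi T' (act M Z)‖) := by
    rw [← hfac, ← norm_mul, ← norm_mul]; rfl
  rw [hterm, hsize]
  calc _ ≤ δ ^ (-((l : ℝ) + k) / 2) * ((C₁ * (1 + (d₁ / δ) ^ (-b))) *
        Real.exp (-(2 * π * (c' * c) * (ρ / δ)))) := by gcongr
    _ = C₁ * (δ ^ (-((l : ℝ) + k) / 2) * (1 + (d₁ / δ) ^ (-b)) *
        Real.exp (-(2 * π * (c' * c) * (ρ / δ)))) := by ring
    _ ≤ C₁ * (C₂ * ((ρ + G) ^ 3)⁻¹) := by gcongr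
    _ = _ := by ring

/-- Uniform convergence by the Weierstrass criterion: the majorant is summable, since cosets are
determined by their bottom rows. -/
theorem poincareTerm_converges {k l : ℕ} {b : ℝ} (hb : IsShimuraExponent k b)
    (hl : (6 : ℝ) ≤ (l : ℝ) + (k : ℝ) - 2 * b) {T T' : Matrix (Fin 2) (Fin 2) ℝ} (hT : T.PosDef)
    (hT' : T'.PosDef) {K : Set (Matrix (Fin 2) (Fin 2) ℂ)} (hK : IsCompact K)
    (hKH : K ⊆ siegelUpperHalfSpace) :
    SummableUniformlyOn (fun (q : Cosets) Z => ‖poincareTerm k l T T' q Z‖) K ∧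
      HasSumUniformlyOn (fun (q : Cosets) Z => poincareTerm k l T T' q Z)
        (fun Z => poincareSeries k l T T' Z) K := by
  obtain ⟨C, hC, h⟩ := exists_norm_cosetRepTerm_le hb hl hT hT' hK hKH
  have hu : Summable fun q : Cosets =>
      C * (gramSize (bottomRow q.out 0) (bottomRow q.out 1) ^ 3)⁻¹ :=
    (summable_gramSize_inv.comp_injective bottomRow_out_injective).mul_left C
  refine ⟨(HasSumUniformlyOn.of_norm_le_summable hu fun q Z hZ => ?_).summableUniformlyOn,
    HasSumUniformlyOn.of_norm_le_summable hu fun q Z hZ => h Z hZ q.out⟩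
  rw [norm_norm]
  exact h Z hZ q.out

/-! ### Existence of an admissible exponent -/

/-- The matrix of the linear map `W ↦ P W Pᵀ` on symmetric matrices in the coordinates of
`symMat`. -/
def congrMatrix (P : Matrix (Fin 2) (Fin 2) ℝ) : Matrix (Fin 3) (Fin 3) ℝ :=
  !![P 0 0 ^ 2, 2 * P 0 0 * P 0 1, P 0 1 ^ 2;
    P 0 0 * P 1 0, P 0 0 * P 1 1 + P 0 1 * P 1 0, P 0 1 * P 1 1;
    P 1 0 ^ 2, 2 * P 1 0 * P 1 1, P 1 1 ^ 2]

theorem det_congrMatrix (P : Matrix (Fin 2) (Fin 2) ℝ) : (congrMatrix P).det = P.det ^ 3 := by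
  simp [congrMatrix, det_fin_three, det_fin_two]; ring

theorem symMat_congrMatrix_mulVec (P : Matrix (Fin 2) (Fin 2) ℝ) (w : Fin 3 → ℝ) :
    symMat (congrMatrix P *ᵥ w) = P * symMat w * Pᵀ := by
  ext i j
  fin_cases i <;> fin_cases j <;>
    simp [symMat, congrMatrix, mulVec, dotProduct, Fin.sum_univ_three, Matrix.mul_apply,
      Fin.sum_univ_two] <;> ring

theorem symMat_add (u v : Fin 3 → ℝ) : symMat (u + v) = symMat u + symMat v := by
  ext i j
  fin_cases i <;> fin_cases j <;> simp [symMat]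

theorem symMat_injective : Function.Injective symMat := by
  intro u v h
  ext i
  fin_cases i
  · simpa [symMat] using congrFun (congrFun h 0) 0
  · simpa [symMat] using congrFun (congrFun h 0) 1
  · simpa [symMat] using congrFun (congrFun h 1) 1

theorem symMat_one : symMat ![1, 0, 1] = 1 := by
  ext i j
  fin_cases i <;> fin_cases j <;> simp [symMat]

theorem exists_symMat_eq {S : Matrix (Fin 2) (Fin 2) ℝ} (hS : S 1 0 = S 0 1) :
    ∃ w, symMat w = S := by
  refine ⟨![S 0 0, S 0 1, S 1 1], ?_⟩
  ext i j
  fin_cases i <;> fin_cases j <;> simp [symMat, hS]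

theorem posDef_conj_iff {P S : Matrix (Fin 2) (Fin 2) ℝ} (hP : P.det ≠ 0) :
    (P * S * Pᵀ).PosDef ↔ S.PosDef := by
  have hu : IsUnit P := (isUnit_iff_isUnit_det P).mpr (Ne.isUnit hP)
  have := IsUnit.posDef_star_right_conjugate_iff (x := S) hu
  rwa [star_eq_conjTranspose, conjTranspose_eq_transpose_of_trivial] at this

/-- The affine change of variables `U = P (W + 1) Pᵀ` in the coordinates of `symMat`. -/
def congrMap (P : Matrix (Fin 2) (Fin 2) ℝ) (w : Fin 3 → ℝ) : Fin 3 → ℝ :=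
  congrMatrix P *ᵥ (w + ![1, 0, 1])

theorem symMat_congrMap (P : Matrix (Fin 2) (Fin 2) ℝ) (w : Fin 3 → ℝ) :
    symMat (congrMap P w) = P * symMat w * Pᵀ + P * Pᵀ := by
  rw [congrMap, symMat_congrMatrix_mulVec, symMat_add, symMat_one, Matrix.mul_add, Matrix.mul_one,
    Matrix.add_mul]

theorem congrMap_injective {P : Matrix (Fin 2) (Fin 2) ℝ} (hP : P.det ≠ 0) :
    Function.Injective (congrMap P) := by
  intro w w' h
  have hu : IsUnit (congrMatrix P) := by
    rw [isUnit_iff_isUnit_det, det_congrMatrix]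
    exact (pow_ne_zero 3 hP).isUnit
  exact add_right_cancel (mulVec_injective_iff_isUnit.mpr hu h)

theorem congrMap_hasFDerivAt (P : Matrix (Fin 2) (Fin 2) ℝ) (w : Fin 3 → ℝ) :
    HasFDerivAt (congrMap P) (LinearMap.toContinuousLinearMap (toLin' (congrMatrix P))) w := by
  have h := (LinearMap.toContinuousLinearMap (toLin' (congrMatrix P))).hasFDerivAt
    (x := w + ![1, 0, 1])
  have h2 := h.comp w ((hasFDerivAt_id w).add_const ![1, 0, 1])
  rwa [ContinuousLinearMap.comp_id] at h2

theorem image_congrMap {T P : Matrix (Fin 2) (Fin 2) ℝ} (hP : P.det ≠ 0) (hT : T = P * Pᵀ) :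
    congrMap P '' {w | (symMat w).PosDef} =
      {u : Fin 3 → ℝ | (symMat u + T).PosDef ∧ (symMat u - T).PosDef} := by
  have hsub (w : Fin 3 → ℝ) : symMat (congrMap P w) - T = P * symMat w * Pᵀ := by
    rw [symMat_congrMap, hT, add_sub_cancel_right]
  ext u
  constructor
  · rintro ⟨w, hw, rfl⟩
    have h1 : (symMat (congrMap P w) - T).PosDef := by
      rw [hsub]; exact (posDef_conj_iff hP).mpr hw
    have hTpos : T.PosDef := by
      have := (posDef_conj_iff (S := 1) hP).mpr PosDef.one
      rwa [Matrix.mul_one, ← hT] at this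
    refine ⟨?_, h1⟩
    have e : symMat (congrMap P w) + T = (symMat (congrMap P w) - T) + (T + T) := by abel
    rw [e]
    exact h1.add (hTpos.add hTpos)
  · rintro ⟨-, hu⟩
    have hPP : P * P⁻¹ = 1 := mul_nonsing_inv _ (Ne.isUnit hP)
    have hPP' : P⁻¹ᵀ * Pᵀ = 1 := by rw [← transpose_mul, hPP, transpose_one]
    have e : P * (P⁻¹ * (symMat u - T) * P⁻¹ᵀ) * Pᵀ = symMat u - T := by
      calc P * (P⁻¹ * (symMat u - T) * P⁻¹ᵀ) * Pᵀ
          = (P * P⁻¹) * (symMat u - T) * (P⁻¹ᵀ * Pᵀ) := by noncomm_ring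
        _ = _ := by rw [hPP, hPP', Matrix.one_mul, Matrix.mul_one]
    have hpd : (P⁻¹ * (symMat u - T) * P⁻¹ᵀ).PosDef := by
      rw [← posDef_conj_iff hP, e]; exact hu
    obtain ⟨w, hw⟩ := exists_symMat_eq (posDef_fin_two_iff.mp hpd).1
    refine ⟨w, by rwa [← hw] at hpd, symMat_injective ?_⟩
    rw [symMat_congrMap, hw, e, ← hT, sub_add_cancel]

theorem det_symMat_add_two_pos {w : Fin 3 → ℝ} (hw : (symMat w).PosDef) :
    0 < (symMat w + 2).det := by
  have h2 : (2 : Matrix (Fin 2) (Fin 2) ℝ) = 1 + 1 := one_add_one_eq_two.symm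
  rw [h2]
  exact (hw.add (PosDef.one.add PosDef.one)).det_pos

/-- The function of `W = symMat w` whose integral over the cone of positive definite matrices is,
up to explicit factors, the confluent hypergeometric integral after diagonalizing `T Y` to
`diag(s₀, s₁)`. -/
def coneIntegrand (k : ℕ) (s : Fin 2 → ℝ) (w : Fin 3 → ℝ) : ℝ :=
  (symMat w + 2).det ^ ((k : ℝ) - 1 / 2) * (symMat w).det ^ (-(1 / 2) : ℝ) *
    Real.exp (-(2 * π * s 0 * w 0 + 2 * π * s 1 * w 2))

/-- The substitution `U = P (W + 1) Pᵀ` turns `U - T` and `U + T` into `P W Pᵀ` and `P (W + 2) Pᵀ`,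
and has Jacobian `|det P|³ = (det T)^(3/2)`. -/
theorem confluentH_eq {k : ℕ} {T Y P : Matrix (Fin 2) (Fin 2) ℝ} {s : Fin 2 → ℝ} (hP : P.det ≠ 0)
    (hT : T = P * Pᵀ) (hY : Pᵀ * Y * P = diagonal s) :
    confluentH (k + 1) 1 T Y = T.det * T.det ^ ((k : ℝ) - 1 / 2) *
      Real.exp (-2 * π * (T * Y).trace) *
      ∫ w in {w : Fin 3 → ℝ | (symMat w).PosDef}, coneIntegrand k s w := by
  have hmeas : MeasurableSet {w : Fin 3 → ℝ | (symMat w).PosDef} := by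
    simpa using measurableSet_posDef_symMat_add 0
  have htd : T.det = P.det ^ 2 := by rw [hT, det_mul, det_transpose, sq]
  have ht0 : 0 < T.det := by rw [htd]; positivity
  unfold confluentH
  rw [← image_congrMap hP hT, integral_image_eq_integral_abs_det_fderiv_smul volume hmeas
    (fun w _ => (congrMap_hasFDerivAt P w).hasFDerivWithinAt) (congrMap_injective hP).injOn,
    ← integral_const_mul]
  refine setIntegral_congr_fun hmeas fun w hw => ?_
  have hw' : (symMat w).PosDef := hw
  have hdet : |(LinearMap.toContinuousLinearMap (toLin' (congrMatrix P))).det| = |P.det| ^ 3 := by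
    rw [LinearMap.det_toContinuousLinearMap, LinearMap.det_toLin', det_congrMatrix, abs_pow]
  have hsub : (symMat (congrMap P w) - T).det = T.det * (symMat w).det := by
    rw [symMat_congrMap, ← hT, add_sub_cancel_right, det_mul, det_mul, det_transpose, htd]; ring
  have hadd : (symMat (congrMap P w) + T).det = T.det * (symMat w + 2).det := by
    have e : symMat (congrMap P w) + T = P * (symMat w + 2) * Pᵀ := by
      rw [symMat_congrMap, hT, Matrix.mul_add, Matrix.add_mul, add_assoc, ← two_mul]
      congr 1
      rw [← Matrix.mul_assoc]; congr 1
      rw [two_mul, mul_two]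
    rw [e, det_mul, det_mul, det_transpose, htd]; ring
  have h2 := det_symMat_add_two_pos hw'
  have htr : (Y * symMat (congrMap P w)).trace = (T * Y).trace + (s 0 * w 0 + s 1 * w 2) := by
    rw [symMat_congrMap, Matrix.mul_add, trace_add, ← hT, trace_mul_comm Y T, add_comm]
    congr 1
    calc (Y * (P * symMat w * Pᵀ)).trace = ((Y * P * symMat w) * Pᵀ).trace := by
          simp only [Matrix.mul_assoc]
      _ = (Pᵀ * Y * P * symMat w).trace := by rw [trace_mul_comm]; simp only [Matrix.mul_assoc]
      _ = _ := by rw [hY]; simp [trace_fin_two, symMat, Matrix.mul_apply, Fin.sum_univ_two]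
  have habs : |P.det| ^ 3 = T.det * T.det ^ (1 / 2 : ℝ) := by
    rw [← Real.sqrt_eq_rpow, htd, Real.sqrt_sq_eq_abs, ← sq_abs]; ring
  have hexpo : ((k : ℝ) + 1 - 3 / 2) = k - 1 / 2 := by ring
  have hexpo' : ((1 : ℝ) - 3 / 2) = -(1 / 2) := by ring
  have hcancel : T.det ^ (1 / 2 : ℝ) * T.det ^ (-(1 / 2) : ℝ) = 1 := by
    rw [← Real.rpow_add ht0]; norm_num
  have hexp : Real.exp (-2 * π * (Y * symMat (congrMap P w)).trace) =
      Real.exp (-2 * π * (T * Y).trace) *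
        Real.exp (-(2 * π * s 0 * w 0 + 2 * π * s 1 * w 2)) := by
    rw [htr, ← Real.exp_add]; ring_nf
  simp only [coneIntegrand, smul_eq_mul]
  rw [hdet, hsub, hadd, hexp, habs, hexpo, hexpo', Real.mul_rpow ht0.le h2.le,
    Real.mul_rpow ht0.le hw'.det_pos.le]
  calc _ = T.det * T.det ^ ((k : ℝ) - 1 / 2) * Real.exp (-2 * π * (T * Y).trace) *
        ((symMat w + 2).det ^ ((k : ℝ) - 1 / 2) * (symMat w).det ^ (-(1 / 2) : ℝ) *
        Real.exp (-(2 * π * s 0 * w 0 + 2 * π * s 1 * w 2))) *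
        (T.det ^ (1 / 2 : ℝ) * T.det ^ (-(1 / 2) : ℝ)) := by ring
    _ = _ := by rw [hcancel, mul_one]

/-- The exact value is `π`; any bound that is independent of `A` suffices. -/
theorem lintegral_inv_sqrt_le {A : ℝ} (hA : 0 < A) :
    ∫⁻ x in {x : ℝ | x ^ 2 < A}, ENNReal.ofReal ((A - x ^ 2) ^ (-(1 / 2) : ℝ)) ≤
      ENNReal.ofReal 8 := by
  set r := √A with hr
  have hr0 : 0 < r := Real.sqrt_pos.mpr hA
  have hrA : A = r ^ 2 := (Real.sq_sqrt hA.le).symm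
  have hset : {x : ℝ | x ^ 2 < A} ⊆ Set.Ioc (-r) r := by
    intro x hx
    have hx' : x ^ 2 < r ^ 2 := by rw [← hrA]; exact hx
    obtain ⟨h1, h2⟩ := abs_lt_of_sq_lt_sq' hx' hr0.le
    exact ⟨h1, h2.le⟩
  set p : ℝ := -(1 / 2) with hp
  have hp1 : -1 < p := by norm_num [hp]
  set h : ℝ → ℝ := fun x => r ^ p * ((r - x) ^ p + (r + x) ^ p) with hh
  have hi1 : IntervalIntegrable (fun x => (r - x) ^ p) volume (-r) r := by
    have := (intervalIntegral.intervalIntegrable_rpow' (a := 2 * r) (b := 0) hp1).comp_sub_left r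
    convert this using 1 <;> ring
  have hi2 : IntervalIntegrable (fun x => (r + x) ^ p) volume (-r) r := by
    have := (intervalIntegral.intervalIntegrable_rpow' (a := 0) (b := 2 * r) hp1).comp_add_left r
    convert this using 1 <;> ring
  have hint : IntervalIntegrable h volume (-r) r := (hi1.add hi2).const_mul _
  have hval : ∫ x in (-r)..r, h x = 4 * (r ^ p * (2 * r) ^ (p + 1)) := by
    rw [hh, intervalIntegral.integral_const_mul, intervalIntegral.integral_add hi1 hi2,
      intervalIntegral.integral_comp_sub_left (fun x => x ^ p) r,
      intervalIntegral.integral_comp_add_left (fun x => x ^ p) r]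
    have e1 : r - r = 0 := sub_self r
    have e2 : r - -r = 2 * r := by ring
    have e3 : r + -r = 0 := by ring
    have e4 : r + r = 2 * r := by ring
    rw [e1, e2, e3, e4, integral_rpow (Or.inl hp1), Real.zero_rpow (by norm_num [hp])]
    rw [hp]; norm_num; ring
  have hval8 : ∫ x in (-r)..r, h x ≤ 8 := by
    have e1 : r ^ p * r ^ (p + 1) = 1 := by
      rw [← Real.rpow_add hr0, hp]; norm_num
    have e2 : (2 : ℝ) ^ (p + 1) ≤ 2 := by
      calc (2 : ℝ) ^ (p + 1) ≤ 2 ^ (1 : ℝ) :=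
            Real.rpow_le_rpow_of_exponent_le (by norm_num) (by norm_num [hp])
        _ = 2 := Real.rpow_one 2
    rw [hval, Real.mul_rpow (by norm_num) hr0.le]
    nlinarith
  have hh0 : ∀ x ∈ Set.Ioc (-r) r, 0 ≤ h x := by
    intro x hx
    have : 0 ≤ r - x := by linarith [hx.2]
    have : 0 ≤ r + x := by linarith [hx.1]
    simp only [hh]; positivity
  have hpt : ∀ x ∈ {x : ℝ | x ^ 2 < A}, (A - x ^ 2) ^ p ≤ h x := by
    intro x hx
    have hx' : x ^ 2 < r ^ 2 := by rw [← hrA]; exact hx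
    obtain ⟨h1, h2⟩ := abs_lt_of_sq_lt_sq' hx' hr0.le
    have p1 : 0 < r - x := by linarith
    have p2 : 0 < r + x := by linarith
    have q0 := Real.rpow_pos_of_pos hr0 p
    have q1 := Real.rpow_pos_of_pos p1 p
    have q2 := Real.rpow_pos_of_pos p2 p
    have e : A - x ^ 2 = (r - x) * (r + x) := by rw [hrA]; ring
    rw [e, Real.mul_rpow p1.le p2.le, hh]
    -- one of the two factors is at least `r`
    rcases le_total 0 x with hx0 | hx0
    · have : (r + x) ^ p ≤ r ^ p :=
        Real.rpow_le_rpow_of_nonpos hr0 (by linarith) (by norm_num [hp])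
      nlinarith
    · have : (r - x) ^ p ≤ r ^ p :=
        Real.rpow_le_rpow_of_nonpos hr0 (by linarith) (by norm_num [hp])
      nlinarith
  have hmeas : MeasurableSet {x : ℝ | x ^ 2 < A} :=
    (isOpen_lt (by fun_prop) continuous_const).measurableSet
  calc _ ≤ ∫⁻ x in {x : ℝ | x ^ 2 < A}, ENNReal.ofReal (h x) :=
        setLIntegral_mono' hmeas fun x hx => ENNReal.ofReal_le_ofReal (hpt x hx)
    _ ≤ ∫⁻ x in Set.Ioc (-r) r, ENNReal.ofReal (h x) := lintegral_mono_set hset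
    _ = ENNReal.ofReal (∫ x in Set.Ioc (-r) r, h x) := by
      rw [ofReal_integral_eq_lintegral_ofReal]
      · exact (intervalIntegrable_iff_integrableOn_Ioc_of_le (by linarith)).mp hint
      · exact (ae_restrict_iff' measurableSet_Ioc).mpr (Filter.Eventually.of_forall hh0)
    _ ≤ ENNReal.ofReal 8 := by
      rw [← intervalIntegral.integral_of_le (by linarith)]
      exact ENNReal.ofReal_le_ofReal hval8

theorem lintegral_pow_mul_exp_le (k : ℕ) {c : ℝ} (hc : 0 < c) :
    ∫⁻ x in Set.Ioi (0 : ℝ), ENNReal.ofReal ((2 + x) ^ k * Real.exp (-(c * x))) ≤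
      ENNReal.ofReal (2 ^ k * (2 ^ k + k.factorial) * (c⁻¹ * (1 + c⁻¹ ^ k))) := by
  have hval (n : ℕ) : ∫ x in Set.Ioi (0 : ℝ), x ^ n * Real.exp (-(c * x)) =
      c⁻¹ ^ (n + 1) * n.factorial := by
    have h := Real.integral_rpow_mul_exp_neg_mul_Ioi (a := n + 1) (r := c) (by positivity) hc
    rw [Real.Gamma_nat_eq_factorial, one_div, add_sub_cancel_right] at h
    rw [← Nat.cast_succ] at h
    simpa only [Real.rpow_natCast] using h
  have hint (n : ℕ) : IntegrableOn (fun x => x ^ n * Real.exp (-(c * x))) (Set.Ioi 0) :=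
    Integrable.of_integral_ne_zero (by rw [hval]; positivity)
  set h : ℝ → ℝ := fun x => 2 ^ k * 2 ^ k * (x ^ 0 * Real.exp (-(c * x))) +
    2 ^ k * (x ^ k * Real.exp (-(c * x))) with hh
  have hhint : IntegrableOn h (Set.Ioi 0) :=
    ((hint 0).const_mul _).add ((hint k).const_mul _)
  have hpt : ∀ x ∈ Set.Ioi (0 : ℝ), (2 + x) ^ k * Real.exp (-(c * x)) ≤ h x := by
    intro x hx
    have hx0 : 0 < x := hx
    have : (2 + x) ^ k ≤ 2 ^ k * 2 ^ k + 2 ^ k * x ^ k := by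
      rw [← mul_pow, ← mul_pow]
      rcases le_total x 2 with h | h
      · have := pow_le_pow_left₀ (by positivity) (by linarith : 2 + x ≤ 2 * 2) k
        linarith [pow_nonneg (by positivity : 0 ≤ 2 * x) k]
      · have := pow_le_pow_left₀ (by positivity) (by linarith : 2 + x ≤ 2 * x) k
        linarith [pow_nonneg (by positivity : (0 : ℝ) ≤ 2 * 2) k]
    calc _ ≤ (2 ^ k * 2 ^ k + 2 ^ k * x ^ k) * Real.exp (-(c * x)) := by gcongr
      _ = _ := by rw [hh]; ring
  calc _ ≤ ∫⁻ x in Set.Ioi (0 : ℝ), ENNReal.ofReal (h x) :=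
        setLIntegral_mono' measurableSet_Ioi fun x hx => ENNReal.ofReal_le_ofReal (hpt x hx)
    _ = ENNReal.ofReal (∫ x in Set.Ioi (0 : ℝ), h x) := by
      rw [ofReal_integral_eq_lintegral_ofReal hhint]
      refine (ae_restrict_iff' measurableSet_Ioi).mpr (Filter.Eventually.of_forall fun x hx => ?_)
      have hx0 : 0 < x := hx
      simp only [hh, Pi.zero_apply]; positivity
    _ ≤ _ := by
      apply ENNReal.ofReal_le_ofReal
      rw [hh, integral_add ((hint 0).const_mul _) ((hint k).const_mul _), integral_const_mul,
        integral_const_mul, hval, hval]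
      have hci : 0 < c⁻¹ := inv_pos.mpr hc
      have h1 : 0 ≤ (2 : ℝ) ^ k * k.factorial * c⁻¹ := by positivity
      have h2 : 0 ≤ (2 : ℝ) ^ k * 2 ^ k * c⁻¹ * c⁻¹ ^ k := by positivity
      rw [pow_succ c⁻¹ k]
      simp only [zero_add, pow_one, Nat.factorial_zero, Nat.cast_one, mul_one]
      nlinarith

/-- Tonelli's theorem for the coordinates of `symMat`, the off-diagonal one first. -/
theorem lintegral_fin_three_le {φ₀ φ₁ : ℝ → ENNReal} {ψ : ℝ → ℝ → ℝ → ENNReal} {B : ENNReal}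
    (h₀ : Measurable φ₀) (h₁ : Measurable φ₁)
    (hψ : Measurable fun w : Fin 3 → ℝ => ψ (w 0) (w 1) (w 2))
    (hB : ∀ x y : ℝ, 0 < x → 0 < y → ∫⁻ z, ψ x z y ≤ B)
    (hφ₀ : ∀ x ≤ 0, φ₀ x = 0) (hφ₁ : ∀ x ≤ 0, φ₁ x = 0) :
    ∫⁻ w : Fin 3 → ℝ, φ₀ (w 0) * φ₁ (w 2) * ψ (w 0) (w 1) (w 2) ≤
      B * ((∫⁻ x, φ₀ x) * ∫⁻ x, φ₁ x) := by
  have hF : Measurable fun w : Fin 3 → ℝ => φ₀ (w 0) * φ₁ (w 2) * ψ (w 0) (w 1) (w 2) :=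
    ((h₀.comp (measurable_pi_apply 0)).mul (h₁.comp (measurable_pi_apply 2))).mul hψ
  set e := MeasurableEquiv.piFinSuccAbove (fun _ : Fin 3 => ℝ) 1 with he
  have hmp : MeasurePreserving e := volume_preserving_piFinSuccAbove (fun _ : Fin 3 => ℝ) 1
  have hmp2 := volume_preserving_piFinTwo fun _ : Fin 2 => ℝ
  have hF' : Measurable fun a : ℝ × (Fin 2 → ℝ) => φ₀ (e.symm a 0) * φ₁ (e.symm a 2) *
      ψ (e.symm a 0) (e.symm a 1) (e.symm a 2) := hF.comp e.symm.measurable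
  rw [← hmp.symm.lintegral_comp hF, Measure.volume_eq_prod, lintegral_prod_symm' _ hF']
  have hcoord (z : ℝ) (p : Fin 2 → ℝ) : e.symm (z, p) 0 = p 0 ∧ e.symm (z, p) 1 = z ∧
      e.symm (z, p) 2 = p 1 := by
    refine ⟨?_, ?_, ?_⟩
    · exact Fin.insertNth_apply_succAbove (α := fun _ => ℝ) 1 z p 0
    · exact Fin.insertNth_apply_same (α := fun _ => ℝ) 1 z p
    · exact Fin.insertNth_apply_succAbove (α := fun _ => ℝ) 1 z p 1
  have hinner (p : Fin 2 → ℝ) : ∫⁻ z, φ₀ (e.symm (z, p) 0) * φ₁ (e.symm (z, p) 2) *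
      ψ (e.symm (z, p) 0) (e.symm (z, p) 1) (e.symm (z, p) 2) ≤ B * (φ₀ (p 0) * φ₁ (p 1)) := by
    simp only [hcoord]
    by_cases hp : 0 < p 0 ∧ 0 < p 1
    · have hm : Measurable fun z => ψ (p 0) z (p 1) := by
        have : Measurable fun z : ℝ => (![p 0, z, p 1] : Fin 3 → ℝ) := by
          refine measurable_pi_lambda _ fun i => ?_
          fin_cases i <;> simp <;> fun_prop
        exact hψ.comp this
      rw [lintegral_const_mul _ hm, mul_comm]
      gcongr
      exact hB _ _ hp.1 hp.2
    · have h0 : φ₀ (p 0) * φ₁ (p 1) = 0 := by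
        rcases not_and_or.mp hp with h | h
        · rw [hφ₀ _ (not_lt.mp h), zero_mul]
        · rw [hφ₁ _ (not_lt.mp h), mul_zero]
      simp [h0]
  have hφ : Measurable fun p : ℝ × ℝ => φ₀ p.1 * φ₁ p.2 :=
    (h₀.comp measurable_fst).mul (h₁.comp measurable_snd)
  calc _ ≤ ∫⁻ p : Fin 2 → ℝ, B * (φ₀ (p 0) * φ₁ (p 1)) := lintegral_mono hinner
    _ = B * ∫⁻ p : Fin 2 → ℝ, φ₀ (p 0) * φ₁ (p 1) :=
      lintegral_const_mul _
        ((h₀.comp (measurable_pi_apply 0)).mul (h₁.comp (measurable_pi_apply 1)))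
    _ = B * ∫⁻ p : ℝ × ℝ, φ₀ p.1 * φ₁ p.2 := by
      rw [← hmp2.lintegral_comp hφ]; rfl
    _ = B * ((∫⁻ x, φ₀ x) * ∫⁻ x, φ₁ x) := by
      rw [Measure.volume_eq_prod, lintegral_prod_mul h₀.aemeasurable h₁.aemeasurable]

theorem posDef_symMat_iff {w : Fin 3 → ℝ} :
    (symMat w).PosDef ↔ 0 < w 0 ∧ 0 < w 2 ∧ w 1 ^ 2 < w 0 * w 2 := by
  have hdet : (symMat w).det = w 0 * w 2 - w 1 ^ 2 := by
    simp [symMat, det_fin_two]; ring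
  rw [posDef_fin_two_iff, hdet]
  simp only [symMat, of_apply, cons_val', cons_val_zero, cons_val_one, true_and, cons_val_fin_one,
    sub_pos]
  constructor
  · rintro ⟨h1, h2⟩
    exact ⟨h1, pos_of_mul_pos_right ((sq_nonneg _).trans_lt h2) h1.le, h2⟩
  · rintro ⟨h1, -, h2⟩
    exact ⟨h1, h2⟩

/-- Hadamard's inequality separates the diagonal variables of the cone integral. -/
theorem coneIntegrand_le {k : ℕ} (s : Fin 2 → ℝ) {w : Fin 3 → ℝ} (hw : (symMat w).PosDef) :
    coneIntegrand k s w ≤ ((2 + w 0) ^ k * Real.exp (-(2 * π * s 0 * w 0))) *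
      ((2 + w 2) ^ k * Real.exp (-(2 * π * s 1 * w 2))) *
      (w 0 * w 2 - w 1 ^ 2) ^ (-(1 / 2) : ℝ) := by
  obtain ⟨h0, h2, h1⟩ := posDef_symMat_iff.mp hw
  have hdet : (symMat w).det = w 0 * w 2 - w 1 ^ 2 := by
    simp [symMat, det_fin_two]; ring
  have hdet2 : (symMat w + 2).det = (2 + w 0) * (2 + w 2) - w 1 ^ 2 := by
    simp [symMat, det_fin_two, Matrix.ofNat_apply]; ring
  have hpos : 0 < w 0 * w 2 - w 1 ^ 2 := by linarith
  have hone : 1 ≤ (2 + w 0) * (2 + w 2) - w 1 ^ 2 := by nlinarith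
  have hk : ((2 + w 0) * (2 + w 2) - w 1 ^ 2) ^ ((k : ℝ) - 1 / 2) ≤
      (2 + w 0) ^ k * (2 + w 2) ^ k := by
    calc ((2 + w 0) * (2 + w 2) - w 1 ^ 2) ^ ((k : ℝ) - 1 / 2)
        ≤ ((2 + w 0) * (2 + w 2) - w 1 ^ 2) ^ (k : ℝ) :=
          Real.rpow_le_rpow_of_exponent_le hone (by linarith)
      _ = ((2 + w 0) * (2 + w 2) - w 1 ^ 2) ^ k := Real.rpow_natCast _ _
      _ ≤ ((2 + w 0) * (2 + w 2)) ^ k := by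
          gcongr
          linarith [sq_nonneg (w 1)]
      _ = _ := mul_pow _ _ _
  have hq := Real.rpow_nonneg hpos.le (-(1 / 2) : ℝ)
  rw [coneIntegrand, hdet, hdet2, neg_add, Real.exp_add]
  calc _ ≤ (2 + w 0) ^ k * (2 + w 2) ^ k * (w 0 * w 2 - w 1 ^ 2) ^ (-(1 / 2) : ℝ) *
        (Real.exp (-(2 * π * s 0 * w 0)) * Real.exp (-(2 * π * s 1 * w 2))) := by gcongr
    _ = _ := by ring

/-- The integral over the off-diagonal variable is bounded by a constant, and those over the diagonal
variables are at most a constant times `s⁻¹ (1 + lam⁻ᵏ)`. -/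
theorem integral_coneIntegrand_le (k : ℕ) : ∃ C : ℝ, 0 < C ∧ ∀ (s : Fin 2 → ℝ) (lam : ℝ),
    0 < lam → (∀ i, lam ≤ s i) →
    ∫ w in {w : Fin 3 → ℝ | (symMat w).PosDef}, coneIntegrand k s w ≤
      C * ((s 0 * s 1)⁻¹ * (1 + lam⁻¹ ^ (2 * k))) := by
  set D : ℝ := 2 ^ k * (2 ^ k + k.factorial) with hD
  have hD0 : 0 < D := by positivity
  refine ⟨8 * (D * D) * 2, by positivity, fun s lam hlam hs => ?_⟩
  have hs0 (i : Fin 2) : 0 < s i := hlam.trans_le (hs i)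
  set φ : Fin 2 → ℝ → ENNReal := fun i => (Set.Ioi (0 : ℝ)).indicator fun x =>
    ENNReal.ofReal ((2 + x) ^ k * Real.exp (-(2 * π * s i * x))) with hφ
  set ψ : ℝ → ℝ → ℝ → ENNReal := fun x z y => {z : ℝ | z ^ 2 < x * y}.indicator
    (fun z => ENNReal.ofReal ((x * y - z ^ 2) ^ (-(1 / 2) : ℝ))) z with hψ
  have hφm (i : Fin 2) : Measurable (φ i) := by
    refine Measurable.indicator ?_ measurableSet_Ioi
    fun_prop
  have hψm : Measurable fun w : Fin 3 → ℝ => ψ (w 0) (w 1) (w 2) := by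
    have : (fun w : Fin 3 → ℝ => ψ (w 0) (w 1) (w 2)) =
        {w : Fin 3 → ℝ | w 1 ^ 2 < w 0 * w 2}.indicator
          fun w => ENNReal.ofReal ((w 0 * w 2 - w 1 ^ 2) ^ (-(1 / 2) : ℝ)) := rfl
    rw [this]
    refine Measurable.indicator ?_ (isOpen_lt (by fun_prop) (by fun_prop)).measurableSet
    fun_prop
  have hψB : ∀ x y : ℝ, 0 < x → 0 < y → ∫⁻ z, ψ x z y ≤ ENNReal.ofReal 8 := by
    intro x y hx hy
    have hmeas : MeasurableSet {z : ℝ | z ^ 2 < x * y} :=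
      (isOpen_lt (by fun_prop) continuous_const).measurableSet
    simp only [hψ]
    rw [lintegral_indicator hmeas]
    exact lintegral_inv_sqrt_le (mul_pos hx hy)
  have hφ0 (i : Fin 2) : ∀ x ≤ 0, φ i x = 0 := fun x hx =>
    Set.indicator_of_notMem (by simpa using hx) _
  have hφi (i : Fin 2) : ∫⁻ x, φ i x ≤ ENNReal.ofReal (D * ((s i)⁻¹ * (1 + lam⁻¹ ^ k))) := by
    simp only [hφ]
    rw [lintegral_indicator measurableSet_Ioi]
    refine (lintegral_pow_mul_exp_le k (by have := hs0 i; positivity)).trans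
      (ENNReal.ofReal_le_ofReal ?_)
    have h1 : s i ≤ 2 * π * s i := by nlinarith [hs0 i, Real.pi_gt_three]
    have h2 : (2 * π * s i)⁻¹ ≤ (s i)⁻¹ := inv_anti₀ (hs0 i) h1
    have h3 : (2 * π * s i)⁻¹ ≤ lam⁻¹ := inv_anti₀ hlam ((hs i).trans h1)
    have h4 : 0 < (2 * π * s i)⁻¹ := inv_pos.mpr ((hs0 i).trans_le h1)
    have h5 := hs0 i
    gcongr
  have hdom : ∫⁻ w in {w : Fin 3 → ℝ | (symMat w).PosDef}, ENNReal.ofReal ‖coneIntegrand k s w‖ ≤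
      ∫⁻ w : Fin 3 → ℝ, φ 0 (w 0) * φ 1 (w 2) * ψ (w 0) (w 1) (w 2) := by
    have hmeas : MeasurableSet {w : Fin 3 → ℝ | (symMat w).PosDef} := by
      simpa using measurableSet_posDef_symMat_add 0
    refine (setLIntegral_mono' hmeas fun w hw => ?_).trans (setLIntegral_le_lintegral _ _)
    obtain ⟨h0, h2, h1⟩ := posDef_symMat_iff.mp hw
    have hnn : 0 ≤ coneIntegrand k s w := by
      have ha := PosDef.det_pos hw
      have hb := det_symMat_add_two_pos hw
      unfold coneIntegrand; positivity
    have e0 : φ 0 (w 0) = ENNReal.ofReal ((2 + w 0) ^ k * Real.exp (-(2 * π * s 0 * w 0))) :=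
      Set.indicator_of_mem (s := Set.Ioi (0 : ℝ)) h0 _
    have e2 : φ 1 (w 2) = ENNReal.ofReal ((2 + w 2) ^ k * Real.exp (-(2 * π * s 1 * w 2))) :=
      Set.indicator_of_mem (s := Set.Ioi (0 : ℝ)) h2 _
    have e1 : ψ (w 0) (w 1) (w 2) = ENNReal.ofReal ((w 0 * w 2 - w 1 ^ 2) ^ (-(1 / 2) : ℝ)) :=
      Set.indicator_of_mem (s := {z : ℝ | z ^ 2 < w 0 * w 2}) h1 _
    rw [e0, e1, e2, ← ENNReal.ofReal_mul (by positivity), ← ENNReal.ofReal_mul (by positivity),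
      Real.norm_of_nonneg hnn]
    exact ENNReal.ofReal_le_ofReal (coneIntegrand_le s hw)
  have htotal := hdom.trans ((lintegral_fin_three_le (hφm 0) (hφm 1) hψm hψB (hφ0 0) (hφ0 1)).trans
    (mul_le_mul_right (mul_le_mul' (hφi 0) (hφi 1)) _))
  have hi0 := hs0 0
  have hi1 := hs0 1
  rw [← ENNReal.ofReal_mul (by positivity), ← ENNReal.ofReal_mul (by norm_num)] at htotal
  have hfin := (Real.le_norm_self _).trans
    (norm_integral_le_lintegral_norm (μ := volume.restrict {w : Fin 3 → ℝ | (symMat w).PosDef})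
      (coneIntegrand k s))
  refine hfin.trans ((ENNReal.toReal_le_of_le_ofReal (by positivity) htotal).trans ?_)
  have hx : 0 < lam⁻¹ ^ k := by positivity
  have hsq : (1 + lam⁻¹ ^ k) * (1 + lam⁻¹ ^ k) ≤ 2 * (1 + lam⁻¹ ^ (2 * k)) := by
    rw [mul_comm 2 k, pow_mul]; nlinarith [sq_nonneg (1 - lam⁻¹ ^ k)]
  calc _ = 8 * (D * D) * ((s 0 * s 1)⁻¹ * ((1 + lam⁻¹ ^ k) * (1 + lam⁻¹ ^ k))) := by
        rw [mul_inv]; ring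
    _ ≤ 8 * (D * D) * ((s 0 * s 1)⁻¹ * (2 * (1 + lam⁻¹ ^ (2 * k)))) := by gcongr
    _ = _ := by ring

/-- The exponent `b = 2 k` is admissible. -/
theorem isShimuraExponent_two_mul {k : ℕ} (hk : 0 < k) : IsShimuraExponent k (2 * k) := by
  obtain ⟨C, hC, hint⟩ := integral_coneIntegrand_le k
  refine ⟨by positivity, C * (2 * π) ^ 2 / (2 ^ (2 * k + 2) * π), by positivity,
    fun T Y hT hY lam hlam => ?_⟩
  have ht := hT.det_pos
  have hy := hY.det_pos
  obtain ⟨P, s, hP, hTP, hYP, hs⟩ := exists_simultaneous_diagonalization hT hY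
  obtain ⟨hdet, -⟩ := det_trace_mul_eq hP hTP hYP
  rw [spectrum_mul_eq_range hP hTP hYP] at hlam
  have hlam0 : 0 < lam := by
    obtain ⟨i, hi⟩ := hlam.1
    exact hi ▸ hs i
  have hI := hint s lam hlam0 fun i => hlam.2 ⟨i, rfl⟩
  have hpow : lam ^ (-(2 * k : ℝ)) = lam⁻¹ ^ (2 * k) := by
    rw [Real.rpow_neg hlam0.le, inv_pow]
    congr 1
    exact_mod_cast Real.rpow_natCast lam (2 * k)
  have hf := shimura_factor_eq (k := (k : ℝ)) ht hy
  have e1 : ((2 * π) • (T * Y)).det = (2 * π) ^ 2 * (T.det * Y.det) := by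
    rw [det_smul, det_mul]; simp
  have e2 : ((2 * π) • Y).det = (2 * π) ^ 2 * Y.det := by
    rw [det_smul]; simp
  have hs0 := hs 0
  have hs1 := hs 1
  rw [hpow, confluentH_eq hP hTP hYP]
  set E := Real.exp (-2 * π * (T * Y).trace) with hE
  have hE0 : 0 < E := Real.exp_pos _
  set F := T.det * T.det ^ ((k : ℝ) - 1 / 2) with hF
  have hF0 : 0 < F := by positivity
  calc _ ≤ (T * Y).det * (F * E * (C * ((s 0 * s 1)⁻¹ * (1 + lam⁻¹ ^ (2 * k))))) := by
        rw [hdet]; gcongr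
    _ = F * E * C * (1 + lam⁻¹ ^ (2 * k)) := by
        rw [hdet]; field_simp
    _ = 2 ^ (2 * k + 2) * π * (F / (2 * π) ^ 2) *
        (C * (2 * π) ^ 2 / (2 ^ (2 * k + 2) * π) * E * (1 + lam⁻¹ ^ (2 * k))) := by
        field_simp
    _ = _ := by rw [e1, e2, ← hf, det_mul]; ring

end SiegelPoincare

end

theorem mainTheorem3 (k : ℕ) (hk : 0 < k) (hk_even : Even k) :
    (∃ b : ℝ, SiegelPoincare.IsShimuraExponent k b) ∧
    ∀ b : ℝ, SiegelPoincare.IsShimuraExponent k b →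
      ∀ l : ℕ, 0 < l → Even l → (6 : ℝ) ≤ (l : ℝ) + (k : ℝ) - 2 * b →
      ∀ T T' : Matrix (Fin 2) (Fin 2) ℝ,
        T.PosDef → SiegelPoincare.IsHalfIntegral T →
        T'.PosDef → SiegelPoincare.IsHalfIntegral T' →
        ∀ K : Set (Matrix (Fin 2) (Fin 2) ℂ), IsCompact K →
          K ⊆ SiegelPoincare.siegelUpperHalfSpace →
          SummableUniformlyOn
            (fun (q : SiegelPoincare.Cosets) (Z : Matrix (Fin 2) (Fin 2) ℂ) =>
              ‖SiegelPoincare.poincareTerm k l T T' q Z‖) K ∧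
          HasSumUniformlyOn
            (fun (q : SiegelPoincare.Cosets) (Z : Matrix (Fin 2) (Fin 2) ℂ) =>
              SiegelPoincare.poincareTerm k l T T' q Z)
            (fun Z => SiegelPoincare.poincareSeries k l T T' Z) K := by
  refine ⟨⟨_, SiegelPoincare.isShimuraExponent_two_mul hk⟩, ?_⟩
  intro b hb l _ _ hlb T T' hT _ hT' _ K hK hKH
  exact SiegelPoincare.poincareTerm_converges hb hlb hT hT' hK hKH
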